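/- Let $f_0$ be a probability density on $[0,1]$ that is bounded away from $0$ and twice differentiable on $[0,1]$ with bounded second derivative, and let $X_1,X_2,\dots$ be i.i.d. with density $f_0$; write $F_0^\infty$ for their joint law. For a distribution function $F$ of a probability measure on $[0,1]$ with $F(0)=0$ and an integer $k\ge 1$ put $$b(x;k,F)=\sum_{j=1}^{k}\bigl[F(j/k)-F((j-1)/k)\bigr]\,\beta(x;j,k-j+1),$$ where $\beta(\cdot;a,b)$ is the beta density with parameters $a,b$. Let $\Pi$ be the random Bernstein polynomial prior, i.e. the law of $b(\cdot;k,F)$ where $k$ and $F$ are independent, $k$ has distribution $(p_k)_{k\ge1}$, and $F$ is a Dirichlet process whose base measure $\alpha$ is a finite measure on $[0,1]$ with $\alpha(\{0\})=0$ such that, for some constants $A>0$ and $r\in\mathbb R$, $\alpha\bigl(((j-1)/k,\,j/k]\bigr)\ge A k^{-r}$ for all $1\le j\le k$ (for example, $\alpha$ has a density bounded away from $0$). Suppose that, for all sufficiently large $k$, $p_{k+1}\le p_k$ and $$B\,e^{-\gamma k\log k}\le p_k\le e^{-4k\log k}$$ for some constants $B,\gamma>0$. Let $h(f,g)=\bigl\{\int_0^1(\sqrt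 f-\sqrt g)^2\,dx\bigr\}^{1/2}$ be the Hellinger distance and $$\Pi_n(C)=\frac{\int_C\prod_{i=1}^n f(X_i)\,\Pi(df)}{\int\prod_{i=1}^n f(X_i)\,\Pi(df)}$$ the posterior distribution. Then $F_0^\infty$-almost surely the posterior is a well-defined probability measure for every $n$, and the posterior converges to $f_0$ in Hellinger distance at rate $\varepsilon_n=(\log n)^{1/3}/n^{1/3}$: for all sufficiently large constants $M$, $$\Pi_n\bigl(\{f:h(f,f_0)>M\varepsilon_n\}\bigr)\to0\quad\text{in }F_0^\infty\text{-probability}.$$ This rate improves on $(\log n)^{5/6}/n^{1/3}$, that is, $(\log n)^{1/3}/n^{1/3}=o\bigl((\log n)^{5/6}/n^{1/3}\bigr)$ as $n\to\infty$. -/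

import Mathlib

open MeasureTheory ProbabilityTheory Filter Topology
open scoped ENNReal

namespace RandomBernstein

noncomputable section

/-- The gamma law with shape `a ≥ 0` and rate `1`; for `a = 0` it is the point mass at `0`. -/
def gammaLaw (a : ℝ) : Measure ℝ :=
  if 0 < a then gammaMeasure a 1 else Measure.dirac 0

/-- The Dirichlet distribution with parameters `a i ≥ 0`, not all zero: the law of the vector
`Z i / ∑ j, Z j`, where the `Z i` are independent with gamma laws of shape `a i` and rate `1`.
A coordinate with parameter `0` vanishes almost surely. -/
def dirichletLaw {m : ℕ} (a : Fin m → ℝ) : Measure (Fin m → ℝ) :=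
  (Measure.pi fun i => gammaLaw (a i)).map fun z i => z i / ∑ j, z j

/-- `D` is the law of the Dirichlet process with (finite) base measure `α`: for a random probability
measure `P` with law `D` and every finite measurable partition `A 0, …, A (m - 1)` of the line, the
vector of the `P (A i)` has the Dirichlet distribution with parameters `α (A i)`. -/
structure IsDirichletProcess (α : Measure ℝ) (D : Measure (ProbabilityMeasure ℝ)) : Prop where
  isProbabilityMeasure : IsProbabilityMeasure D
  map_partition : ∀ (m : ℕ) (A : Fin m → Set ℝ), (∀ i, MeasurableSet (A i)) →
    Pairwise (fun i j => Disjoint (A i) (A j)) → (⋃ i, A i) = Set.univ →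
    D.map (fun (P : ProbabilityMeasure ℝ) (i : Fin m) => (P : Measure ℝ).real (A i)) = dirichletLaw fun i => α.real (A i)

/-- The Bernstein density of order `k` of the distribution `P`, whose distribution function is
`F = cdf P`: the sum over `j` of `(F (j / k) - F ((j - 1) / k)) * β(x; j, k - j + 1)`, with
`β(x; a, b)` the beta density. (For `F` with `F 0 = 0` a term `j = 0` would have weight `0`.) -/
def bernsteinDensity (k : ℕ) (P : ProbabilityMeasure ℝ) (x : ℝ) : ℝ :=
  ∑ j ∈ Finset.Icc 1 k,
    (cdf (P : Measure ℝ) ((j : ℝ) / k) - cdf (P : Measure ℝ) (((j : ℝ) - 1) / k)) *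
      betaPDFReal (j : ℝ) ((k : ℝ) - j + 1) x

/-- The law of `(k, P)` when `k` has law `p`, `P` has law `D`, and they are independent. The
random Bernstein polynomial prior is the law of `bernsteinDensity k P`. -/
def bernsteinPrior (p : PMF ℕ) (D : Measure (ProbabilityMeasure ℝ)) :
    Measure (ℕ × ProbabilityMeasure ℝ) :=
  p.toMeasure.prod D

/-- The density-valued map on the parameter space `(k, P)`. -/
def bernsteinModel (θ : ℕ × ProbabilityMeasure ℝ) : ℝ → ℝ :=
  bernsteinDensity θ.1 θ.2

/-- The Hellinger distance of two densities with respect to Lebesgue measure on `[0, 1]`. -/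
def hellinger (f g : ℝ → ℝ) : ℝ :=
  √(∫ x in Set.Icc (0 : ℝ) 1, (√(f x) - √(g x)) ^ 2)

/-- The likelihood of the density `f` at the first `n` observations `x 0, …, x (n - 1)`. -/
def likelihood (f : ℝ → ℝ) (n : ℕ) (x : ℕ → ℝ) : ℝ≥0∞ :=
  ENNReal.ofReal (∏ i ∈ Finset.range n, f (x i))

/-- The posterior distribution, given the first `n` observations, for the prior `prior` on a parameter
space `Θ` indexing the densities `f θ`. The posterior mass of a set `B` of densities is the mass
of `{θ | f θ ∈ B}`. -/
def posterior {Θ : Type*} [MeasurableSpace Θ] (prior : Measure Θ) (f : Θ → ℝ → ℝ)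
    (n : ℕ) (x : ℕ → ℝ) : Measure Θ :=
  (∫⁻ θ, likelihood (f θ) n x ∂prior)⁻¹ • prior.withDensity fun θ => likelihood (f θ) n x

/-- The law on the line with density `f₀` with respect to Lebesgue measure on `[0, 1]`. -/
def densityLaw (f₀ : ℝ → ℝ) : Measure ℝ :=
  (volume.restrict (Set.Icc (0 : ℝ) 1)).withDensity fun x => ENNReal.ofReal (f₀ x)

/-- The law of a sequence of independent observations with density `f₀` on `[0, 1]`. -/
def dataLaw (f₀ : ℝ → ℝ) : Measure (ℕ → ℝ) :=
  Measure.infinitePi fun _ => densityLaw f₀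

/-- The rate `(log n)^{1/3} / n^{1/3}`. -/
def rate (n : ℕ) : ℝ := Real.log n ^ (1 / 3 : ℝ) / (n : ℝ) ^ (1 / 3 : ℝ)

end

end RandomBernstein

/-! Write ε for `rate n`. The rate comes from one balance: with k of order `scale n` = 1/ε, the
quantity n ε² equals `scale n` * log n, which is the order of k log k. Approximation error, prior
mass and entropy all meet at this scale.

Prior mass: a Bernstein density of order k whose coefficients are the cell integrals of f₀ is within
O(1/k) of f₀ in sup norm (`exists_betaMixture_approx`), and moving each coefficient by k⁻² moves the
density by at most 1/k. Through the gamma representation, the Dirichlet process gives such a ball of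
coefficients mass at least exp(-C k log k) (`exists_dirichletProcess_smallBall_ge`), and p_k has a
lower bound of the same form. Hence densities f with ∫ f₀²/f ≤ 1 + O(ε²) have prior mass at least a
constant times exp(-C n ε²) (`exists_priorMass`).

Posterior: the denominator is bounded below by applying Markov's inequality to the inverse
likelihood ratio over this neighbourhood. In the numerator, orders above K, a large multiple of
`scale n`, have prior mass at most a constant times exp(-2 K log K). For orders up to K, rounding
the coefficients up to a fine grid gives exp(O(n ε²)) upper brackets. Markov's inequality for the
square root of a bracket's likelihood ratio brings in the affinity, at most 1 - M² ε²/2 + 1/n for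
brackets of densities outside the Hellinger ball, and a large M beats the number of brackets.
`dataLaw_posterior_gt_le` combines these bounds for a general model,
`dataLaw_bernstein_posterior_gt_le` specialises them, and `bernstein_posterior_contraction` fixes
the constants.

The posterior is well defined because the evidence has expectation at most 1, hence is almost surely
finite, and is positive for observations in (0, 1) (`isProbabilityMeasure_posterior`). -/

namespace RandomBernstein

noncomputable section

/-! ### Bernstein densities as beta mixtures with cell masses as weights. -/

/-- The combination with coefficients `w j` of the beta densities of order `k`. -/
def betaMixture (k : ℕ) (w : ℕ → ℝ) (x : ℝ) : ℝ :=
  ∑ j ∈ Finset.Icc 1 k, w j * betaPDFReal (j : ℝ) ((k : ℝ) - j + 1) x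

/-- The mass that `P` gives to the cell `((j - 1) / k, j / k]`. -/
def cellMass (k : ℕ) (P : ProbabilityMeasure ℝ) (j : ℕ) : ℝ :=
  (P : Measure ℝ).real (Set.Ioc (((j : ℝ) - 1) / k) ((j : ℝ) / k))

lemma cdf_sub_cdf (P : ProbabilityMeasure ℝ) {a b : ℝ} (hab : a ≤ b) :
    cdf (P : Measure ℝ) b - cdf (P : Measure ℝ) a = (P : Measure ℝ).real (Set.Ioc a b) := by
  rw [cdf_eq_real, cdf_eq_real, ← measureReal_sdiff (Set.Iic_subset_Iic.2 hab) measurableSet_Iic]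
  congr 1
  ext x
  simp [and_comm]

lemma bernsteinDensity_eq_betaMixture (k : ℕ) (P : ProbabilityMeasure ℝ) :
    bernsteinDensity k P = betaMixture k (cellMass k P) := by
  ext x
  refine Finset.sum_congr rfl fun j _ => ?_
  rw [cdf_sub_cdf P (by gcongr; linarith), cellMass]

lemma cellMass_nonneg (k : ℕ) (P : ProbabilityMeasure ℝ) (j : ℕ) : 0 ≤ cellMass k P j :=
  measureReal_nonneg

lemma cellMass_le_one (k : ℕ) (P : ProbabilityMeasure ℝ) (j : ℕ) : cellMass k P j ≤ 1 :=
  measureReal_le_one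

lemma sum_cellMass {k : ℕ} (hk : k ≠ 0) (P : ProbabilityMeasure ℝ) :
    ∑ j ∈ Finset.Icc 1 k, cellMass k P j = (P : Measure ℝ).real (Set.Ioc 0 1) := by
  have h : ∀ j ∈ Finset.Icc 1 k, cellMass k P j =
      cdf (P : Measure ℝ) (((j : ℕ) : ℝ) / k) - cdf (P : Measure ℝ) (((j - 1 : ℕ) : ℝ) / k) := by
    intro j hj
    rw [Nat.cast_sub (Finset.mem_Icc.1 hj).1, cdf_sub_cdf P (by gcongr; simp), cellMass]
    simp
  rw [Finset.sum_congr rfl h, ← Finset.Ico_add_one_right_eq_Icc, Finset.sum_Ico_eq_sum_range]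
  have := Finset.sum_range_sub (fun j : ℕ => cdf (P : Measure ℝ) ((j : ℝ) / k)) k
  have hk' : (k : ℝ) ≠ 0 := by exact_mod_cast hk
  rw [← cdf_sub_cdf P zero_le_one]
  simp only [add_tsub_cancel_right, add_tsub_cancel_left]
  simp only [add_comm 1]
  rw [this]
  simp [hk']

lemma sum_cellMass_le_one (k : ℕ) (P : ProbabilityMeasure ℝ) :
    ∑ j ∈ Finset.Icc 1 k, cellMass k P j ≤ 1 := by
  rcases eq_or_ne k 0 with rfl | hk
  · simp
  · rw [sum_cellMass hk]; exact measureReal_le_one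

lemma measurable_real_apply {s : Set ℝ} (hs : MeasurableSet s) :
    Measurable fun P : ProbabilityMeasure ℝ => (P : Measure ℝ).real s :=
  ((Measure.measurable_coe hs).comp measurable_subtype_coe).ennreal_toReal

lemma measurable_cellMass (k j : ℕ) : Measurable fun P => cellMass k P j :=
  measurable_real_apply measurableSet_Ioc

@[fun_prop]
lemma measurable_betaMixture (k : ℕ) (w : ℕ → ℝ) : Measurable (betaMixture k w) := by
  unfold betaMixture
  fun_prop

lemma measurable_uncurry_bernsteinDensity :
    Measurable fun q : ℕ × (ProbabilityMeasure ℝ × ℝ) => bernsteinDensity q.1 q.2.1 q.2.2 := by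
  refine measurable_from_prod_countable_right fun k => ?_
  have h : ∀ j, Measurable fun q : ProbabilityMeasure ℝ × ℝ =>
      cellMass k q.1 j * betaPDFReal (j : ℝ) ((k : ℝ) - j + 1) q.2 := fun j =>
    ((measurable_cellMass k j).comp measurable_fst).mul
      ((measurable_betaPDFReal _ _).comp measurable_snd)
  simpa only [bernsteinDensity_eq_betaMixture, betaMixture] using
    Finset.measurable_sum (Finset.Icc 1 k) fun j _ => h j

lemma measurable_uncurry_bernsteinModel :
    Measurable fun q : (ℕ × ProbabilityMeasure ℝ) × ℝ => bernsteinModel q.1 q.2 :=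
  measurable_uncurry_bernsteinDensity.comp
    (f := fun q : (ℕ × ProbabilityMeasure ℝ) × ℝ => (q.1.1, (q.1.2, q.2)))
    ((measurable_fst.comp measurable_fst).prodMk
      ((measurable_snd.comp measurable_fst).prodMk measurable_snd))

/-! ### Beta densities with integer parameters and Bernstein polynomials. -/

section Beta

variable {k j : ℕ}

lemma beta_parameter_pos (hj : j ∈ Finset.Icc 1 k) : 0 < (j : ℝ) ∧ 0 < (k : ℝ) - j + 1 := by
  rw [Finset.mem_Icc] at hj
  have h1 : (1 : ℝ) ≤ j := by exact_mod_cast hj.1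
  have h2 : (j : ℝ) ≤ k := by exact_mod_cast hj.2
  constructor <;> linarith

lemma betaPDFReal_nonneg (hj : j ∈ Finset.Icc 1 k) (x : ℝ) :
    0 ≤ betaPDFReal (j : ℝ) ((k : ℝ) - j + 1) x := by
  by_cases hx : 0 < x ∧ x < 1
  · exact (betaPDFReal_pos hx.1 hx.2 (beta_parameter_pos hj).1 (beta_parameter_pos hj).2).le
  · rw [betaPDFReal, if_neg hx]

lemma setLIntegral_betaPDFReal (hj : j ∈ Finset.Icc 1 k) :
    ∫⁻ x in Set.Icc (0 : ℝ) 1, ENNReal.ofReal (betaPDFReal (j : ℝ) ((k : ℝ) - j + 1) x) = 1 := by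
  rw [← lintegral_betaPDF_eq_one (beta_parameter_pos hj).1 (beta_parameter_pos hj).2]
  refine setLIntegral_eq_of_support_subset fun x hx => ?_
  by_contra hx'
  apply hx
  simp only [Set.mem_Icc, not_and_or, not_le] at hx'
  rcases hx' with h | h
  · exact betaPDF_eq_zero_of_nonpos h.le
  · exact betaPDF_eq_zero_of_one_le h.le

lemma integrableOn_betaPDFReal (hj : j ∈ Finset.Icc 1 k) :
    IntegrableOn (betaPDFReal (j : ℝ) ((k : ℝ) - j + 1)) (Set.Icc 0 1) := by
  refine ⟨(measurable_betaPDFReal _ _).aestronglyMeasurable, ?_⟩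
  rw [hasFiniteIntegral_iff_ofReal (ae_of_all _ fun x => betaPDFReal_nonneg hj x),
    setLIntegral_betaPDFReal hj]
  exact ENNReal.one_lt_top

lemma setIntegral_betaPDFReal (hj : j ∈ Finset.Icc 1 k) :
    ∫ x in Set.Icc (0 : ℝ) 1, betaPDFReal (j : ℝ) ((k : ℝ) - j + 1) x = 1 := by
  rw [integral_eq_lintegral_of_nonneg_ae (ae_of_all _ fun x => betaPDFReal_nonneg hj x)
    (measurable_betaPDFReal _ _).aestronglyMeasurable, setLIntegral_betaPDFReal hj]
  simp

/-- At integer parameters the gamma functions are factorials. The shift j = i + 1, k = N + 1 makes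
the moment identities of Bernstein polynomials available for beta mixtures. -/
lemma betaPDFReal_eq_eval_bernsteinPolynomial {N i : ℕ} (hi : i ≤ N) {x : ℝ}
    (hx : x ∈ Set.Ioo (0 : ℝ) 1) :
    betaPDFReal ((i + 1 : ℕ) : ℝ) (((N + 1 : ℕ) : ℝ) - ((i + 1 : ℕ) : ℝ) + 1) x =
      (N + 1) * (bernsteinPolynomial ℝ N i).eval x := by
  obtain ⟨l, rfl⟩ := Nat.exists_eq_add_of_le hi
  rw [betaPDFReal, if_pos (show 0 < x ∧ x < 1 from hx), ProbabilityTheory.beta]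
  have e1 : (((i + l + 1 : ℕ) : ℝ) - ((i + 1 : ℕ) : ℝ) + 1) = (l : ℝ) + 1 := by push_cast; ring
  have e2 : ((i + 1 : ℕ) : ℝ) = (i : ℝ) + 1 := by push_cast; ring
  have e3 : (i : ℝ) + 1 + ((l : ℝ) + 1) = ((i + l + 1 : ℕ) : ℝ) + 1 := by push_cast; ring
  rw [e1, e2, e3, Real.Gamma_nat_eq_factorial, Real.Gamma_nat_eq_factorial,
    Real.Gamma_nat_eq_factorial, add_sub_cancel_right, add_sub_cancel_right, Real.rpow_natCast,
    Real.rpow_natCast, bernsteinPolynomial,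
    Nat.choose_eq_factorial_div_factorial hi, add_tsub_cancel_left, Nat.factorial_succ]
  have hd : i.factorial * l.factorial ∣ (i + l).factorial :=
    Nat.factorial_mul_factorial_dvd_factorial_add i l
  simp only [Polynomial.eval_mul, Polynomial.eval_natCast, Polynomial.eval_pow, Polynomial.eval_X,
    Polynomial.eval_sub, Polynomial.eval_one]
  rw [Nat.cast_div hd (by positivity)]
  push_cast
  field_simp

lemma betaMixture_succ (N : ℕ) (w : ℕ → ℝ) {x : ℝ} (hx : x ∈ Set.Ioo (0 : ℝ) 1) :
    betaMixture (N + 1) w x =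
      ∑ i ∈ Finset.range (N + 1), (N + 1) * w (i + 1) * (bernsteinPolynomial ℝ N i).eval x := by
  rw [betaMixture, ← Finset.Ico_add_one_right_eq_Icc, Finset.sum_Ico_eq_sum_range]
  refine Finset.sum_congr (by simp) fun i hi => ?_
  have hi' : i ≤ N := Nat.lt_succ_iff.1 (Finset.mem_range.1 hi)
  rw [add_comm 1 i, betaPDFReal_eq_eval_bernsteinPolynomial hi' hx]
  ring

lemma eval_bernsteinPolynomial_nonneg (N i : ℕ) {x : ℝ} (hx : x ∈ Set.Ioo (0 : ℝ) 1) :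
    0 ≤ (bernsteinPolynomial ℝ N i).eval x := by
  have := hx.1.le
  have := hx.2.le
  have : 0 ≤ 1 - x := by linarith
  simp only [bernsteinPolynomial, Polynomial.eval_mul, Polynomial.eval_natCast, Polynomial.eval_pow,
    Polynomial.eval_X, Polynomial.eval_sub, Polynomial.eval_one]
  positivity

lemma sum_eval_bernsteinPolynomial (N : ℕ) (x : ℝ) :
    ∑ i ∈ Finset.range (N + 1), (bernsteinPolynomial ℝ N i).eval x = 1 := by
  simpa [Polynomial.eval_finsetSum] using congrArg (Polynomial.eval x) (bernsteinPolynomial.sum ℝ N)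

lemma sum_mul_eval_bernsteinPolynomial (N : ℕ) (x : ℝ) :
    ∑ i ∈ Finset.range (N + 1), (i : ℝ) * (bernsteinPolynomial ℝ N i).eval x = N * x := by
  simpa [Polynomial.eval_finsetSum] using
    congrArg (Polynomial.eval x) (bernsteinPolynomial.sum_smul ℝ N)

lemma sum_sq_mul_eval_bernsteinPolynomial (N : ℕ) (x : ℝ) :
    ∑ i ∈ Finset.range (N + 1), (N * x - i) ^ 2 * (bernsteinPolynomial ℝ N i).eval x =
      N * x * (1 - x) := by
  simpa [Polynomial.eval_finsetSum] using
    congrArg (Polynomial.eval x) (bernsteinPolynomial.variance ℝ N)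

end Beta

lemma betaMixture_nonneg {k : ℕ} {w : ℕ → ℝ} (hw : ∀ j ∈ Finset.Icc 1 k, 0 ≤ w j) (x : ℝ) :
    0 ≤ betaMixture k w x :=
  Finset.sum_nonneg fun j hj => mul_nonneg (hw j hj) (betaPDFReal_nonneg hj x)

lemma betaMixture_mono {k : ℕ} {v w : ℕ → ℝ} (h : ∀ j ∈ Finset.Icc 1 k, v j ≤ w j) (x : ℝ) :
    betaMixture k v x ≤ betaMixture k w x :=
  Finset.sum_le_sum fun j hj => mul_le_mul_of_nonneg_right (h j hj) (betaPDFReal_nonneg hj x)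

lemma betaMixture_sub (k : ℕ) (v w : ℕ → ℝ) (x : ℝ) :
    betaMixture k v x - betaMixture k w x = betaMixture k (fun j => v j - w j) x := by
  simp only [betaMixture, ← Finset.sum_sub_distrib, sub_mul]

lemma integrableOn_betaMixture (k : ℕ) (w : ℕ → ℝ) :
    IntegrableOn (betaMixture k w) (Set.Icc 0 1) :=
  integrable_finsetSum _ fun _ hj => (integrableOn_betaPDFReal hj).const_mul _

lemma setIntegral_betaMixture (k : ℕ) (w : ℕ → ℝ) :
    ∫ x in Set.Icc (0 : ℝ) 1, betaMixture k w x = ∑ j ∈ Finset.Icc 1 k, w j := by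
  unfold betaMixture
  rw [integral_finsetSum _ fun j hj => (integrableOn_betaPDFReal hj).const_mul _]
  refine Finset.sum_congr rfl fun j hj => ?_
  rw [integral_const_mul, setIntegral_betaPDFReal hj, mul_one]

/-- The Bernstein polynomials are a partition of unity, so the beta densities of order k add up to k
on (0, 1). -/
lemma abs_betaMixture_le {k : ℕ} {w : ℕ → ℝ} {δ : ℝ} (hw : ∀ j ∈ Finset.Icc 1 k, |w j| ≤ δ)
    {x : ℝ} (hx : x ∈ Set.Ioo (0 : ℝ) 1) : |betaMixture k w x| ≤ k * δ := by
  rcases Nat.eq_zero_or_pos k with rfl | hk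
  · simp [betaMixture]
  obtain ⟨N, rfl⟩ := Nat.exists_eq_succ_of_ne_zero hk.ne'
  rw [Nat.succ_eq_add_one, betaMixture_succ N w hx]
  calc _ ≤ ∑ i ∈ Finset.range (N + 1), |(N + 1) * w (i + 1) * (bernsteinPolynomial ℝ N i).eval x| :=
        Finset.abs_sum_le_sum_abs _ _
    _ ≤ ∑ i ∈ Finset.range (N + 1), (N + 1) * δ * (bernsteinPolynomial ℝ N i).eval x := by
        refine Finset.sum_le_sum fun i hi => ?_
        rw [abs_mul, abs_mul, abs_of_nonneg (eval_bernsteinPolynomial_nonneg N i hx),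
          abs_of_nonneg (by positivity : (0 : ℝ) ≤ N + 1)]
        have : |w (i + 1)| ≤ δ := hw _ (by simp at hi ⊢; omega)
        have := eval_bernsteinPolynomial_nonneg N i hx
        gcongr
    _ = _ := by rw [← Finset.mul_sum, sum_eval_bernsteinPolynomial]; push_cast; ring

/-! ### Approximation of a smooth density by Bernstein densities. -/

section Approximation

variable {f : ℝ → ℝ} {L : ℝ}

/-- First-order Taylor bound under a bounded second derivative. -/
lemma abs_taylor_sub_le
    (hd : DifferentiableOn ℝ f (Set.Icc 0 1))
    (hd' : DifferentiableOn ℝ (derivWithin f (Set.Icc 0 1)) (Set.Icc 0 1))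
    (hL : ∀ x ∈ Set.Icc (0 : ℝ) 1, |derivWithin (derivWithin f (Set.Icc 0 1)) (Set.Icc 0 1) x| ≤ L)
    {x y : ℝ} (hx : x ∈ Set.Icc (0 : ℝ) 1) (hy : y ∈ Set.Icc (0 : ℝ) 1) :
    |f y - f x - derivWithin f (Set.Icc 0 1) x * (y - x)| ≤ L * (y - x) ^ 2 := by
  have hlip : ∀ t ∈ Set.Icc (0 : ℝ) 1,
      |derivWithin f (Set.Icc 0 1) t - derivWithin f (Set.Icc 0 1) x| ≤ L * |t - x| := fun t ht =>
    (convex_Icc (0 : ℝ) 1).norm_image_sub_le_of_norm_derivWithin_le hd' hL hx ht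
  have hsub : Set.uIcc x y ⊆ Set.Icc 0 1 := Set.uIcc_subset_Icc hx hy
  have hL0 : 0 ≤ L := (abs_nonneg _).trans (hL x hx)
  -- Mean value inequality on the segment from x to y for f minus its linear part at x; the
  -- derivative there is at most L |y - x| by `hlip`.
  have := (convex_uIcc x y).norm_image_sub_le_of_norm_hasDerivWithin_le
    (f := fun t => f t - derivWithin f (Set.Icc 0 1) x * t)
    (f' := fun t => derivWithin f (Set.Icc 0 1) t - derivWithin f (Set.Icc 0 1) x * 1)
    (C := L * |y - x|)
    (fun t ht => (((hd t (hsub ht)).hasDerivWithinAt.mono hsub).sub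
      ((hasDerivWithinAt_id t _).const_mul _)))
    (fun t ht => by
      rw [mul_one, Real.norm_eq_abs]
      refine (hlip t (hsub ht)).trans ?_
      exact mul_le_mul_of_nonneg_left (Set.abs_sub_left_of_mem_uIcc ht) hL0)
    Set.left_mem_uIcc Set.right_mem_uIcc
  simp only [Real.norm_eq_abs] at this
  rw [mul_assoc, ← pow_two, sq_abs] at this
  convert this using 2
  ring

lemma exists_lipschitz_bound
    (hd : DifferentiableOn ℝ f (Set.Icc 0 1))
    (hd' : DifferentiableOn ℝ (derivWithin f (Set.Icc 0 1)) (Set.Icc 0 1)) :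
    ∃ Q : ℝ, 0 ≤ Q ∧ ∀ x ∈ Set.Icc (0 : ℝ) 1, ∀ y ∈ Set.Icc (0 : ℝ) 1, |f y - f x| ≤ Q * |y - x| := by
  obtain ⟨Q, hQ⟩ := isCompact_Icc.exists_bound_of_continuousOn hd'.continuousOn
  have h0 : (0 : ℝ) ∈ Set.Icc (0 : ℝ) 1 := by simp
  exact ⟨Q, (norm_nonneg _).trans (hQ 0 h0), fun x hx y hy =>
    (convex_Icc (0 : ℝ) 1).norm_image_sub_le_of_norm_derivWithin_le hd hQ hx hy⟩

/-- Bernstein densities approximate a smooth density at the rate `1 / k`. -/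
lemma exists_betaMixture_approx {c : ℝ}
    (hint : ∫ x in Set.Icc (0 : ℝ) 1, f x = 1) (hc : ∀ x ∈ Set.Icc (0 : ℝ) 1, c ≤ f x)
    (hd : DifferentiableOn ℝ f (Set.Icc 0 1))
    (hd' : DifferentiableOn ℝ (derivWithin f (Set.Icc 0 1)) (Set.Icc 0 1))
    (hL : ∀ x ∈ Set.Icc (0 : ℝ) 1, |derivWithin (derivWithin f (Set.Icc 0 1)) (Set.Icc 0 1) x| ≤ L) :
    ∃ C : ℝ, 0 < C ∧ ∀ k : ℕ, 2 ≤ k → ∃ w : ℕ → ℝ, (∀ j ∈ Finset.Icc 1 k, c / k ≤ w j) ∧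
      ∑ j ∈ Finset.Icc 1 k, w j = 1 ∧
      ∀ x ∈ Set.Ioo (0 : ℝ) 1, |betaMixture k w x - f x| ≤ C / k := by
  obtain ⟨Q, hQ0, hQ⟩ := exists_lipschitz_bound hd hd'
  have hL0 : 0 ≤ L := (abs_nonneg _).trans (hL 0 (by simp))
  -- Q pays for replacing cell averages by point values and 2 L for the quadratic Taylor remainder;
  -- the 1 only makes the constant positive.
  refine ⟨Q + 2 * L + 1, by positivity, fun k hk => ?_⟩
  obtain ⟨N, rfl⟩ := Nat.exists_eq_add_of_le' (show 1 ≤ k by omega)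
  have hN : (1 : ℝ) ≤ N := by exact_mod_cast (by omega : 1 ≤ N)
  have hN0 : (0 : ℝ) < N := by linarith
  have hcell : ∀ i ≤ N, Set.uIcc ((i : ℝ) / (N + 1)) ((i + 1 : ℝ) / (N + 1)) ⊆ Set.Icc 0 1 := by
    intro i hi
    have : (i : ℝ) ≤ N := by exact_mod_cast hi
    refine Set.uIcc_subset_Icc ⟨by positivity, ?_⟩ ⟨by positivity, ?_⟩ <;>
      rw [div_le_one (by positivity)] <;> linarith
  have hii : ∀ i ≤ N, IntervalIntegrable f volume ((i : ℝ) / (N + 1)) ((i + 1 : ℝ) / (N + 1)) :=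
    fun i hi => (hd.continuousOn.mono (hcell i hi)).intervalIntegrable
  have hlen : ∀ i : ℝ, (i + 1) / ((N : ℝ) + 1) - i / (N + 1) = 1 / (N + 1) := fun i => by ring
  have hle : ∀ i : ℝ, i / ((N : ℝ) + 1) ≤ (i + 1) / (N + 1) := fun i => by gcongr; linarith
  -- Taking cell integrals as coefficients gives sum 1 and the lower bound c / k at no cost.
  set w : ℕ → ℝ := fun j => ∫ t in (((j - 1 : ℕ) : ℝ) / (N + 1))..((((j - 1 : ℕ) : ℝ) + 1) / (N + 1)),
    f t with hw
  refine ⟨w, fun j hj => ?_, ?_, fun x hx => ?_⟩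
  · have hj' : j - 1 ≤ N := by simp at hj; omega
    have := intervalIntegral.integral_mono_on (hle ((j - 1 : ℕ) : ℝ)) intervalIntegrable_const
      (hii _ hj') (f := fun _ => c) (fun t ht => hc t (hcell _ hj' (by
        rwa [Set.uIcc_of_le (hle _)])))
    rw [intervalIntegral.integral_const, hlen, smul_eq_mul] at this
    refine le_trans (le_of_eq ?_) this
    push_cast; ring
  · rw [← Finset.Ico_add_one_right_eq_Icc, Finset.sum_Ico_eq_sum_range]
    have := intervalIntegral.sum_integral_adjacent_intervals (μ := volume) (f := f)
      (a := fun i : ℕ => (i : ℝ) / (N + 1)) (n := N + 1) (fun i hi => by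
        simpa using hii i (by omega))
    simp only [hw, add_tsub_cancel_left, add_tsub_cancel_right]
    push_cast at this
    rw [this, zero_div, div_self (by positivity), intervalIntegral.integral_of_le zero_le_one,
      ← integral_Icc_eq_integral_Ioc, hint]
  · have hxI : x ∈ Set.Icc (0 : ℝ) 1 := Set.Ioo_subset_Icc_self hx
    set d := derivWithin f (Set.Icc 0 1) x
    set B : ℕ → ℝ := fun i => (bernsteinPolynomial ℝ N i).eval x with hB
    -- (N + 1) * w (i + 1) is the average of f over a cell of mesh 1 / (N + 1), and the node i / N
    -- lies in that cell. So the average is close to f (i / N), which is then expanded at x.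
    have key : ∀ i ≤ N, |(N + 1) * w (i + 1) - f x - d * (i / N - x)| ≤
        Q / (N + 1) + L * ((i : ℝ) / N - x) ^ 2 := by
      intro i hi
      have hiN : (i : ℝ) ≤ N := by exact_mod_cast hi
      have hyI : (i : ℝ) / N ∈ Set.Icc (0 : ℝ) 1 :=
        ⟨by positivity, by rw [div_le_one hN0]; exact hiN⟩
      have h1 : |(N + 1) * w (i + 1) - f (i / N)| ≤ Q / (N + 1) := by
        have hb := intervalIntegral.norm_integral_le_of_norm_le_const (C := Q / (N + 1))
          (f := fun t => f t - f (i / N)) (a := (i : ℝ) / (N + 1)) (b := (i + 1 : ℝ) / (N + 1))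
          (fun t ht => by
            have ht' := hcell i hi (Set.uIoc_subset_uIcc ht)
            refine (hQ _ hyI _ ht').trans ?_
            rw [div_eq_mul_one_div Q]
            gcongr
            rw [Set.uIoc_of_le (hle _)] at ht
            have e1 : (i : ℝ) / (N + 1) ≤ i / N := by gcongr; linarith
            have e2 : (i : ℝ) / N ≤ (i + 1) / (N + 1) := by
              rw [div_le_div_iff₀ hN0 (by positivity)]; nlinarith
            have := hlen i
            rw [abs_le]; constructor <;> linarith [ht.1, ht.2])
        rw [intervalIntegral.integral_sub (hii i hi) intervalIntegrable_const,
          intervalIntegral.integral_const, hlen, abs_of_nonneg (by positivity), smul_eq_mul,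
          Real.norm_eq_abs] at hb
        have e : (N + 1) * w (i + 1) - f (i / N) = (N + 1) * ((∫ t in ((i : ℝ) / (N + 1))..((i + 1 : ℝ) / (N + 1)), f t) - 1 / (N + 1) * f (i / N)) := by
          simp only [hw, add_tsub_cancel_right]
          field_simp
        rw [e, abs_mul, abs_of_nonneg (by positivity)]
        calc _ ≤ ((N : ℝ) + 1) * (Q / (N + 1) * (1 / (N + 1))) := by gcongr
          _ = _ := by field_simp
      have h2 := abs_taylor_sub_le hd hd' hL hxI hyI
      calc _ = |((N + 1) * w (i + 1) - f (i / N)) + (f (i / N) - f x - d * (i / N - x))| := by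
            congr 1; ring
        _ ≤ _ := (abs_add_le _ _).trans (add_le_add h1 h2)
    -- Bernstein operators reproduce affine functions, so the first-order term contributes nothing.
    have hmean : ∑ i ∈ Finset.range (N + 1), (f x + d * (i / N - x)) * B i = f x := by
      have e : ∀ i ∈ Finset.range (N + 1), (f x + d * ((i : ℝ) / N - x)) * B i =
          (f x - d * x) * B i + d / N * (i * B i) := fun i _ => by field_simp; ring
      rw [Finset.sum_congr rfl e, Finset.sum_add_distrib, ← Finset.mul_sum, ← Finset.mul_sum,
        sum_eval_bernsteinPolynomial, sum_mul_eval_bernsteinPolynomial]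
      field_simp; ring
    have hvar : ∑ i ∈ Finset.range (N + 1), (Q / (N + 1) + L * ((i : ℝ) / N - x) ^ 2) * B i =
        Q / (N + 1) + L * (x * (1 - x)) / N := by
      have e : ∀ i ∈ Finset.range (N + 1), (Q / (N + 1) + L * ((i : ℝ) / N - x) ^ 2) * B i =
          Q / (N + 1) * B i + L / N ^ 2 * ((N * x - i) ^ 2 * B i) := fun i _ => by
        field_simp; ring
      rw [Finset.sum_congr rfl e, Finset.sum_add_distrib, ← Finset.mul_sum, ← Finset.mul_sum,
        sum_eval_bernsteinPolynomial, sum_sq_mul_eval_bernsteinPolynomial]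
      field_simp
    rw [betaMixture_succ N w hx]
    refine le_trans (le_of_eq (congrArg (fun t => |_ - t|) hmean.symm)) ?_
    rw [← Finset.sum_sub_distrib]
    calc _ ≤ ∑ i ∈ Finset.range (N + 1), (Q / (N + 1) + L * ((i : ℝ) / N - x) ^ 2) * B i := by
          refine (Finset.abs_sum_le_sum_abs _ _).trans (Finset.sum_le_sum fun i hi => ?_)
          rw [← sub_mul, abs_mul, abs_of_nonneg (eval_bernsteinPolynomial_nonneg N i hx), ← sub_sub]
          exact mul_le_mul_of_nonneg_right (key i (by simp at hi; omega))
            (eval_bernsteinPolynomial_nonneg N i hx)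
      _ = Q / (N + 1) + L * (x * (1 - x)) / N := hvar
      -- N ≥ (N + 1) / 2 because k ≥ 2.
      _ ≤ Q / (N + 1) + L * 1 / ((N + 1) / 2) := by
          gcongr
          · nlinarith [hx.1, hx.2]
          · linarith
      _ ≤ _ := by
          push_cast
          rw [← sub_nonneg]
          have : (Q + 2 * L + 1) / ((N : ℝ) + 1) - (Q / (N + 1) + L * 1 / ((N + 1) / 2)) = 1 / (N + 1) := by
            field_simp; ring
          rw [this]; positivity

end Approximation

/-! ### Small-ball bounds for gamma and Dirichlet laws. -/

instance isProbabilityMeasure_gammaLaw (a : ℝ) : IsProbabilityMeasure (gammaLaw a) := by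
  unfold gammaLaw
  split_ifs with h
  · exact isProbabilityMeasure_gammaMeasure h one_pos
  · infer_instance

/-- Shapes may be arbitrarily small, where Γ(a) blows up; Γ(a + 1) stays bounded, and 1 / Γ(a) = a /
Γ(a + 1) then gives a bound below that is linear in a. -/
lemma exists_Gamma_bound (T : ℝ) :
    ∃ G : ℝ, 0 < G ∧ ∀ a ∈ Set.Ioc 0 T, Real.Gamma (a + 1) ≤ G := by
  have hcont : ContinuousOn (fun a => Real.Gamma (a + 1)) (Set.Icc 0 T) := by
    intro a ha
    refine ContinuousAt.continuousWithinAt ?_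
    have : ContinuousAt Real.Gamma (a + 1) :=
      (Real.differentiableAt_Gamma fun m => by
        have : (0 : ℝ) ≤ m := m.cast_nonneg
        linarith [ha.1]).continuousAt
    exact ContinuousAt.comp (f := fun a : ℝ => a + 1) this (by fun_prop)
  obtain ⟨G, hG⟩ := isCompact_Icc.exists_bound_of_continuousOn hcont
  refine ⟨max G 1, by positivity, fun a ha => ?_⟩
  exact (le_abs_self _).trans ((hG a ⟨ha.1.le, ha.2⟩).trans (le_max_left _ _))

lemma rpow_sub_one_ge {a T δ x : ℝ} (ha : 0 < a) (haT : a ≤ T) (hδ : 0 < δ) (hδ1 : δ ≤ 1)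
    (hx : δ ≤ x) (hx2 : x ≤ 2) : δ ^ T / 2 ≤ x ^ (a - 1) := by
  have hδT : δ ^ T ≤ 1 := Real.rpow_le_one hδ.le hδ1 (ha.le.trans haT)
  have hx0 : 0 < x := hδ.trans_le hx
  rcases le_total 1 a with h | h
  · calc δ ^ T / 2 ≤ δ ^ T := by linarith [Real.rpow_nonneg hδ.le T]
      _ ≤ δ ^ (a - 1) := Real.rpow_le_rpow_of_exponent_ge hδ hδ1 (by linarith)
      _ ≤ x ^ (a - 1) := Real.rpow_le_rpow hδ.le hx (by linarith)
  · calc δ ^ T / 2 ≤ 1 / 2 := by gcongr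
      _ = (2 : ℝ) ^ (-1 : ℝ) := by rw [Real.rpow_neg_one]; norm_num
      _ ≤ 2 ^ (a - 1) := Real.rpow_le_rpow_of_exponent_le one_le_two (by linarith)
      _ ≤ x ^ (a - 1) := Real.rpow_le_rpow_of_nonpos hx0 hx2 (by linarith)

/-- The gamma density is bounded below on [δ, 2] uniformly over shapes in [a₀, T], polynomially in
a₀ and δ. Taking δ and a₀ polynomial in 1/k therefore costs only a factor log k in the exponent. -/
lemma gammaLaw_Icc_ge {T G a₀ a δ w η : ℝ} (hG : 0 < G)
    (hΓ : ∀ a ∈ Set.Ioc 0 T, Real.Gamma (a + 1) ≤ G) (ha₀ : 0 < a₀) (ha : a₀ ≤ a) (haT : a ≤ T)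
    (hδ : 0 < δ) (hw : δ ≤ w) (hw1 : w ≤ 1) (hη1 : η ≤ 1) :
    ENNReal.ofReal (a₀ / G * (δ ^ T / 2) * Real.exp (-2) * η) ≤ gammaLaw a (Set.Icc w (w + η)) := by
  have ha0 : 0 < a := ha₀.trans_le ha
  rw [gammaLaw, if_pos ha0, gammaMeasure, withDensity_apply _ measurableSet_Icc,
    ENNReal.ofReal_mul (by positivity)]
  calc _ = ∫⁻ x in Set.Icc w (w + η), ENNReal.ofReal (a₀ / G * (δ ^ T / 2) * Real.exp (-2)) := by
        rw [setLIntegral_const, Real.volume_Icc, add_sub_cancel_left]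
    _ ≤ _ := by
        refine setLIntegral_mono' measurableSet_Icc fun x hx => ?_
        have hx0 : δ ≤ x := hw.trans hx.1
        rw [gammaPDF_of_nonneg (hδ.le.trans hx0)]
        refine ENNReal.ofReal_le_ofReal ?_
        have h1 : a₀ / G ≤ 1 ^ a / Real.Gamma a := by
          have hΓa := hΓ a ⟨ha0, haT⟩
          rw [Real.Gamma_add_one ha0.ne'] at hΓa
          have hpos := Real.Gamma_pos_of_pos ha0
          rw [Real.one_rpow, div_le_div_iff₀ hG hpos, one_mul]
          exact (mul_le_mul_of_nonneg_right ha hpos.le).trans hΓa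
        have h2 := rpow_sub_one_ge (x := x) ha0 haT hδ (hw.trans hw1) hx0 (by linarith [hx.2])
        have h3 : Real.exp (-2) ≤ Real.exp (-(1 * x)) := Real.exp_le_exp.2 (by linarith [hx.2])
        have := Real.Gamma_pos_of_pos ha0
        have : 0 ≤ x := hδ.le.trans hx0
        gcongr

/-- Normalizing a positive vector that is close to a probability vector keeps it close. -/
lemma abs_div_sum_sub_le {k : ℕ} {w z : Fin k → ℝ} {η : ℝ} (hw : ∀ i, 0 ≤ w i)
    (hsum : ∑ i, w i = 1) (hz : ∀ i, z i ∈ Set.Icc (w i) (w i + η)) (i : Fin k) :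
    |z i / (∑ j, z j) - w i| ≤ k * η := by
  have hk : (1 : ℝ) ≤ k := by exact_mod_cast Fin.pos i
  have hη : 0 ≤ η := by linarith [(hz i).1, (hz i).2]
  have h1 : 1 ≤ ∑ j, z j := by rw [← hsum]; exact Finset.sum_le_sum fun j _ => (hz j).1
  have h2 : ∑ j, z j ≤ 1 + k * η := by
    calc _ ≤ ∑ j, (w j + η) := Finset.sum_le_sum fun j _ => (hz j).2
      _ = _ := by simp [Finset.sum_add_distrib, hsum]
  have hw1 : w i ≤ 1 := by
    rw [← hsum]; exact Finset.single_le_sum (fun j _ => hw j) (Finset.mem_univ i)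
  set s := ∑ j, z j
  have hs : 0 < s := by linarith
  have e : z i / s - w i = (z i - w i * s) / s := by field_simp
  rw [e, abs_div, abs_of_pos hs, div_le_iff₀ hs]
  have hk' : k * η ≤ k * η * s := le_mul_of_one_le_right (by positivity) h1
  have hkη : η ≤ k * η := le_mul_of_one_le_left hη hk
  rw [abs_le]
  constructor
  · have : w i * s ≤ w i * (1 + k * η) := mul_le_mul_of_nonneg_left h2 (hw i)
    have : w i * (k * η) ≤ 1 * (k * η) := mul_le_mul_of_nonneg_right hw1 (by positivity)
    linarith [(hz i).1]
  · have : w i * 1 ≤ w i * s := mul_le_mul_of_nonneg_left h1 (hw i)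
    linarith [(hz i).2]

lemma measurable_div_sum (m : ℕ) :
    Measurable fun (z : Fin m → ℝ) i => z i / ∑ j, z j := by fun_prop

/-- Small-ball probability of a Dirichlet distribution whose first parameter vanishes. -/
lemma dirichletLaw_cons_zero_ge {k : ℕ} {a w : Fin k → ℝ} {η : ℝ} {q : ℝ≥0∞}
    (hw : ∀ i, 0 ≤ w i) (hsum : ∑ i, w i = 1)
    (hq : ∀ i, q ≤ gammaLaw (a i) (Set.Icc (w i) (w i + η))) :
    q ^ k ≤ dirichletLaw (Fin.cons 0 a : Fin (k + 1) → ℝ) {v | ∀ i : Fin k, |v i.succ - w i| ≤ k * η} := by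
  have hmeas : MeasurableSet {v : Fin (k + 1) → ℝ | ∀ i : Fin k, |v i.succ - w i| ≤ k * η} := by
    simp only [Set.ofPred_forall]
    exact MeasurableSet.iInter fun i => measurableSet_le (by fun_prop) measurable_const
  rw [dirichletLaw, Measure.map_apply (measurable_div_sum _) hmeas]
  -- The box is one-sided, z i ≥ w i, so that the normalising sum lies between 1 and 1 + k η.
  set S : Fin (k + 1) → Set ℝ := Fin.cons {0} fun i => Set.Icc (w i) (w i + η)
  calc q ^ k = ∏ _i : Fin k, q := by simp
    _ ≤ ∏ i : Fin k, gammaLaw (a i) (Set.Icc (w i) (w i + η)) := Finset.prod_le_prod' fun i _ => hq i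
    _ = ∏ i, gammaLaw ((Fin.cons 0 a : Fin (k + 1) → ℝ) i) (S i) := by
        rw [Fin.prod_univ_succ]
        simp [S, gammaLaw]
    _ = Measure.pi (fun i => gammaLaw ((Fin.cons 0 a : Fin (k + 1) → ℝ) i)) (Set.univ.pi S) :=
        (Measure.pi_pi _ _).symm
    _ ≤ _ := by
        refine measure_mono fun z hz => ?_
        have h0 : z 0 = 0 := by simpa [S] using hz 0 (Set.mem_univ _)
        have hi : ∀ i : Fin k, z i.succ ∈ Set.Icc (w i) (w i + η) := fun i => by
          simpa [S] using hz i.succ (Set.mem_univ _)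
        intro i
        simp only [Fin.sum_univ_succ, h0, zero_add]
        exact abs_div_sum_sub_le hw hsum hi i

/-! ### Cell masses of a Dirichlet process. -/

/-- The partition of the line into the cells `((j - 1) / k, j / k]` and the complement
of `(0, 1]`. -/
def cellPartition (k : ℕ) : Fin (k + 1) → Set ℝ :=
  Fin.cons (Set.Ioc 0 1)ᶜ fun i => Set.Ioc ((i : ℝ) / k) (((i : ℝ) + 1) / k)

lemma measurableSet_cellPartition (k : ℕ) (i : Fin (k + 1)) : MeasurableSet (cellPartition k i) := by
  refine Fin.cases ?_ (fun i => ?_) i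
  · exact measurableSet_Ioc.compl
  · exact measurableSet_Ioc

lemma cell_subset {k : ℕ} (i : Fin k) :
    Set.Ioc ((i : ℝ) / k) (((i : ℝ) + 1) / k) ⊆ Set.Ioc 0 1 := by
  have hk : (0 : ℝ) < k := by exact_mod_cast Fin.pos i
  have hi : (i : ℝ) + 1 ≤ k := by exact_mod_cast i.2
  intro x hx
  refine ⟨lt_of_le_of_lt (by positivity) hx.1, hx.2.trans ?_⟩
  rwa [div_le_one hk]

lemma pairwise_disjoint_cellPartition (k : ℕ) :
    Pairwise fun i j => Disjoint (cellPartition k i) (cellPartition k j) := by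
  have h0 : ∀ i : Fin k, Disjoint (cellPartition k 0) (cellPartition k i.succ) := fun i =>
    Set.disjoint_compl_left_iff_subset.2 (cell_subset i)
  have h1 : ∀ i j : Fin k, i < j → Disjoint (cellPartition k i.succ) (cellPartition k j.succ) := by
    intro i j hij
    rw [Set.disjoint_left]
    rintro x ⟨-, hx⟩ ⟨hx', -⟩
    have hij' : (i : ℝ) + 1 ≤ j := by exact_mod_cast hij
    have : ((i : ℝ) + 1) / k ≤ j / k := by gcongr
    linarith
  intro i j
  refine Fin.cases (Fin.cases ?_ (fun j => ?_) j) (fun i => Fin.cases ?_ (fun j => ?_) j) i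
  · simp
  · exact fun _ => h0 j
  · exact fun _ => (h0 i).symm
  · intro hij
    rcases lt_trichotomy i j with h | h | h
    · exact h1 i j h
    · exact absurd (by rw [h]) hij
    · exact (h1 j i h).symm

lemma iUnion_cellPartition {k : ℕ} (hk : k ≠ 0) : ⋃ i, cellPartition k i = Set.univ := by
  have hk' : (0 : ℝ) < k := by positivity
  refine Set.eq_univ_of_forall fun x => Set.mem_iUnion.2 ?_
  by_cases hx : x ∈ Set.Ioc (0 : ℝ) 1
  · have hpos : 0 < ⌈x * k⌉₊ := Nat.ceil_pos.2 (mul_pos hx.1 hk')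
    have hle : ⌈x * k⌉₊ ≤ k := Nat.ceil_le.2 (by nlinarith [hx.2])
    have hlt := Nat.ceil_lt_add_one (mul_pos hx.1 hk').le
    have hge := Nat.le_ceil (x * k)
    refine ⟨Fin.succ ⟨⌈x * k⌉₊ - 1, by omega⟩, ?_⟩
    have hc : ((⌈x * k⌉₊ - 1 : ℕ) : ℝ) = (⌈x * k⌉₊ : ℝ) - 1 := by
      rw [Nat.cast_sub hpos]; simp
    simp only [cellPartition, Fin.cons_succ, hc, Set.mem_Ioc, sub_add_cancel]
    rw [div_lt_iff₀ hk', le_div_iff₀ hk']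
    constructor <;> linarith
  · exact ⟨0, hx⟩

section DirichletProcess

variable {α : Measure ℝ} {D : Measure (ProbabilityMeasure ℝ)}

lemma measurable_real_apply_pi {m : ℕ} {A : Fin m → Set ℝ} (hA : ∀ i, MeasurableSet (A i)) :
    Measurable fun (P : ProbabilityMeasure ℝ) i => (P : Measure ℝ).real (A i) :=
  measurable_pi_lambda _ fun i => measurable_real_apply (hA i)

lemma measurable_forall_cellMass (k : ℕ) (w : ℕ → ℝ) (δ : ℝ) :
    MeasurableSet {P | ∀ j ∈ Finset.Icc 1 k, |cellMass k P j - w j| ≤ δ} := by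
  simp only [Set.ofPred_forall]
  exact Finset.measurableSet_biInter _ fun j _ => measurableSet_le
    (continuous_abs.measurable.comp ((measurable_cellMass k j).sub_const _)) measurable_const

/-- A Dirichlet process with base measure carried by `(0, 1]` is carried by `(0, 1]`. -/
lemma ae_real_Ioc_eq_one (hα : α (Set.Ioc 0 1)ᶜ = 0) (hD : IsDirichletProcess α D) :
    ∀ᵐ P : ProbabilityMeasure ℝ ∂D, (P : Measure ℝ).real (Set.Ioc 0 1) = 1 := by
  -- For k = 1 the partition consists of (0, 1] and its complement; the complement has parameter 0,
  -- so its gamma variable vanishes.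
  have hm := measurableSet_cellPartition 1
  have h := hD.map_partition 2 (cellPartition 1) hm (pairwise_disjoint_cellPartition 1)
    (iUnion_cellPartition one_ne_zero)
  have hae : ∀ᵐ v ∂dirichletLaw fun i => α.real (cellPartition 1 i), v 0 = 0 := by
    rw [dirichletLaw, ae_map_iff (measurable_div_sum _).aemeasurable
      (measurableSet_eq_fun (measurable_pi_apply 0) measurable_const)]
    have h0 : ∀ᵐ x ∂gammaLaw (α.real (cellPartition 1 0)), x = 0 := by
      simp [cellPartition, measureReal_def, hα, gammaLaw]
    have := (measurePreserving_eval (fun i => gammaLaw (α.real (cellPartition 1 i))) 0).quasiMeasurePreserving.ae h0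
    filter_upwards [this] with z hz
    rw [Function.eval] at hz
    rw [hz, zero_div]
  rw [← h, ae_map_iff (measurable_real_apply_pi hm).aemeasurable
    (measurableSet_eq_fun (measurable_pi_apply 0) measurable_const)] at hae
  filter_upwards [hae] with P hP
  have hP' : (P : Measure ℝ).real (Set.Ioc 0 1)ᶜ = 0 := hP
  rw [probReal_compl_eq_one_sub measurableSet_Ioc] at hP'
  linarith

/-- Small-ball probability of the cell masses of a Dirichlet process. -/
lemma dirichletProcess_smallBall_ge {k : ℕ} (hk : k ≠ 0) (hα : α (Set.Ioc 0 1)ᶜ = 0)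
    (hD : IsDirichletProcess α D) {w : ℕ → ℝ} {η : ℝ} {q : ℝ≥0∞}
    (hw : ∀ j ∈ Finset.Icc 1 k, 0 ≤ w j) (hsum : ∑ j ∈ Finset.Icc 1 k, w j = 1)
    (hq : ∀ j ∈ Finset.Icc 1 k, q ≤ gammaLaw (α.real (Set.Ioc (((j : ℝ) - 1) / k) ((j : ℝ) / k)))
      (Set.Icc (w j) (w j + η))) :
    q ^ k ≤ D {P | ∀ j ∈ Finset.Icc 1 k, |cellMass k P j - w j| ≤ k * η} := by
  have hm := measurableSet_cellPartition k
  have h := hD.map_partition (k + 1) (cellPartition k) hm (pairwise_disjoint_cellPartition k)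
    (iUnion_cellPartition hk)
  have hmem : ∀ i : Fin k, (i : ℕ) + 1 ∈ Finset.Icc 1 k := fun i => by
    have := i.2
    simp
  have hcons : (fun i => α.real (cellPartition k i)) =
      Fin.cons 0 fun i : Fin k => α.real (Set.Ioc ((i : ℝ) / k) (((i : ℝ) + 1) / k)) := by
    ext i
    refine Fin.cases ?_ (fun i => ?_) i
    · simp [cellPartition, measureReal_def, hα]
    · simp [cellPartition]
  have hsum' : ∑ i : Fin k, w (i + 1) = 1 := by
    rw [← hsum, ← Finset.Ico_add_one_right_eq_Icc, Finset.sum_Ico_eq_sum_range,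
      ← Fin.sum_univ_eq_sum_range (fun i => w (1 + i))]
    simp [add_comm]
  have key := dirichletLaw_cons_zero_ge (q := q) (η := η)
    (a := fun i : Fin k => α.real (Set.Ioc ((i : ℝ) / k) (((i : ℝ) + 1) / k)))
    (w := fun i : Fin k => w (i + 1)) (fun i => hw _ (hmem i)) hsum' (fun i => by
      simpa using hq _ (hmem i))
  rw [← hcons, ← h, Measure.map_apply (measurable_real_apply_pi hm)] at key
  · refine key.trans (measure_mono fun P hP j hj => ?_)
    rw [Finset.mem_Icc] at hj
    have := hP ⟨j - 1, by omega⟩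
    simp only [cellPartition, Fin.cons_succ, Nat.cast_sub hj.1, Nat.sub_add_cancel hj.1] at this
    simpa [cellMass] using this
  · simp only [Set.ofPred_forall]
    exact MeasurableSet.iInter fun i => measurableSet_le (by fun_prop) measurable_const

/-- The small-ball probability is at least `exp (-C k log k)`. -/
lemma exists_dirichletProcess_smallBall_ge [IsFiniteMeasure α] (hα : α (Set.Ioc 0 1)ᶜ = 0)
    (hα_low : ∃ A b : ℝ, 0 < A ∧ ∀ k : ℕ, ∀ j ∈ Finset.Icc 1 k,
      A * (k : ℝ) ^ (-b) ≤ α.real (Set.Ioc (((j : ℝ) - 1) / k) ((j : ℝ) / k)))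
    (hD : IsDirichletProcess α D) {c : ℝ} (hc : 0 < c) :
    ∃ C : ℝ, 0 < C ∧ ∀ᶠ k : ℕ in atTop, ∀ w : ℕ → ℝ, (∀ j ∈ Finset.Icc 1 k, c / k ≤ w j) →
      ∑ j ∈ Finset.Icc 1 k, w j = 1 →
      ENNReal.ofReal (Real.exp (-C * k * Real.log k)) ≤
        D {P | ∀ j ∈ Finset.Icc 1 k, |cellMass k P j - w j| ≤ 1 / (k : ℝ) ^ 2} := by
  obtain ⟨A, b, hA, hlow⟩ := hα_low
  set T := α.real Set.univ
  have hT : 0 ≤ T := measureReal_nonneg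
  obtain ⟨G, hG, hΓ⟩ := exists_Gamma_bound T
  set K₀ := A / G * (c ^ T / 2) * Real.exp (-2) with hK₀
  have hK₀pos : 0 < K₀ := by positivity
  -- Powers of k: |b| from the base measure, T from the gamma density near 0, 3 from the side of the
  -- box, and one more to absorb the constant K₀.
  refine ⟨|b| + T + 4, by positivity, ?_⟩
  have hinv : ∀ᶠ k : ℕ in atTop, (k : ℝ)⁻¹ ≤ K₀ :=
    (tendsto_inv_atTop_nhds_zero_nat (𝕜 := ℝ)).eventually_le_const hK₀pos
  filter_upwards [hinv, eventually_ge_atTop 1] with k hkinv hk w hw hsum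
  have hk0 : (0 : ℝ) < k := by positivity
  have hk1 : (1 : ℝ) ≤ k := by exact_mod_cast hk
  have hw0 : ∀ j ∈ Finset.Icc 1 k, 0 ≤ w j := fun j hj => le_trans (by positivity) (hw j hj)
  have hw1 : ∀ j ∈ Finset.Icc 1 k, w j ≤ 1 := fun j hj => by
    rw [← hsum]; exact Finset.single_le_sum hw0 hj
  set q := A * (k : ℝ) ^ (-b) / G * ((c / k) ^ T / 2) * Real.exp (-2) * (1 / (k : ℝ) ^ 3) with hq
  -- Normalisation multiplies the side by k, so side k⁻³ gives radius k⁻², that is, 1 / k for the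
  -- densities.
  have hball := dirichletProcess_smallBall_ge (η := 1 / (k : ℝ) ^ 3) (q := ENNReal.ofReal q)
    (by omega) hα hD hw0 hsum (fun j hj => gammaLaw_Icc_ge hG hΓ (by positivity) (hlow k j hj)
      (measureReal_mono (Set.subset_univ _)) (by positivity) (hw j hj) (hw1 j hj)
      (by rw [div_le_one (by positivity)]; exact one_le_pow₀ hk1))
  have e1 : (k : ℝ) * (1 / (k : ℝ) ^ 3) = 1 / (k : ℝ) ^ 2 := by field_simp
  rw [e1] at hball
  refine le_trans ?_ hball
  rw [← ENNReal.ofReal_pow (by positivity)]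
  refine ENNReal.ofReal_le_ofReal ?_
  have e2 : q = K₀ * (k : ℝ) ^ (-b - T - 3) := by
    rw [Real.rpow_sub hk0, Real.rpow_sub hk0, hq, hK₀, Real.div_rpow hc.le hk0.le]
    norm_cast
    field_simp
  have e3 : (k : ℝ) ^ (-(|b| + T + 4)) ≤ q := by
    rw [e2]
    calc (k : ℝ) ^ (-(|b| + T + 4)) ≤ (k : ℝ) ^ (-1 + (-b - T - 3)) :=
          Real.rpow_le_rpow_of_exponent_le hk1 (by linarith [neg_abs_le b, le_abs_self b])
      _ = (k : ℝ)⁻¹ * (k : ℝ) ^ (-b - T - 3) := by rw [Real.rpow_add hk0, Real.rpow_neg_one]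
      _ ≤ _ := by gcongr
  calc Real.exp (-(|b| + T + 4) * k * Real.log k) = ((k : ℝ) ^ (-(|b| + T + 4))) ^ k := by
        rw [Real.rpow_def_of_pos hk0, ← Real.exp_nat_mul]
        ring_nf
    _ ≤ q ^ k := by gcongr

end DirichletProcess

/-! ### Likelihood ratios under the law of the data. -/

/-- The likelihood ratio of `f` and `g` at the first `n` observations. -/
def likelihoodRatio (g f : ℝ → ℝ) (n : ℕ) (x : ℕ → ℝ) : ℝ≥0∞ :=
  ∏ i ∈ Finset.range n, ENNReal.ofReal (f (x i) / g (x i))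

/-- A measurable, everywhere positive function that is a probability density on `[0, 1]`. -/
structure IsPositiveDensity (g : ℝ → ℝ) : Prop where
  measurable : Measurable g
  pos : ∀ x, 0 < g x
  integrableOn : IntegrableOn g (Set.Icc 0 1)
  integral_eq_one : ∫ x in Set.Icc (0 : ℝ) 1, g x = 1

namespace IsPositiveDensity

variable {g : ℝ → ℝ}

lemma lintegral_eq_one (hg : IsPositiveDensity g) : ∫⁻ x in Set.Icc (0 : ℝ) 1, ENNReal.ofReal (g x) = 1 := by
  rw [← ofReal_integral_eq_lintegral_ofReal hg.integrableOn (ae_of_all _ fun x => (hg.pos x).le),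
    hg.integral_eq_one, ENNReal.ofReal_one]

lemma isProbabilityMeasure_densityLaw (hg : IsPositiveDensity g) : IsProbabilityMeasure (densityLaw g) :=
  ⟨by rw [densityLaw, withDensity_apply _ MeasurableSet.univ, Measure.restrict_univ,
    hg.lintegral_eq_one]⟩

lemma isProbabilityMeasure_dataLaw (hg : IsPositiveDensity g) : IsProbabilityMeasure (dataLaw g) := by
  have := hg.isProbabilityMeasure_densityLaw
  unfold dataLaw
  infer_instance

lemma lintegral_densityLaw (hg : IsPositiveDensity g) {φ : ℝ → ℝ≥0∞} (hφ : Measurable φ) :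
    ∫⁻ x, φ x ∂densityLaw g = ∫⁻ x in Set.Icc (0 : ℝ) 1, φ x * ENNReal.ofReal (g x) := by
  rw [densityLaw, lintegral_withDensity_eq_lintegral_mul _ hg.measurable.ennreal_ofReal hφ]
  simp only [Pi.mul_apply, mul_comm]

lemma lintegral_prod_dataLaw (hg : IsPositiveDensity g) {φ : ℝ → ℝ≥0∞} (hφ : Measurable φ) (n : ℕ) :
    ∫⁻ x, ∏ i ∈ Finset.range n, φ (x i) ∂dataLaw g =
      (∫⁻ x in Set.Icc (0 : ℝ) 1, φ x * ENNReal.ofReal (g x)) ^ n := by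
  have := hg.isProbabilityMeasure_densityLaw
  have hind : iIndepFun (fun (i : ℕ) (x : ℕ → ℝ) => φ (x i)) (dataLaw g) :=
    iIndepFun_infinitePi (P := fun _ : ℕ => densityLaw g) (X := fun _ => φ) fun _ => hφ
  rw [lintegral_prod_eq_prod_lintegral_of_indepFun _ _ hind fun i => hφ.comp (measurable_pi_apply i)]
  have h : ∀ i : ℕ, ∫⁻ x, φ (x i) ∂dataLaw g = ∫⁻ y, φ y ∂densityLaw g := fun i =>
    (measurePreserving_eval_infinitePi (fun _ : ℕ => densityLaw g) i).lintegral_comp hφ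
  simp only [h, Finset.prod_const, Finset.card_range, hg.lintegral_densityLaw hφ]

lemma lintegral_likelihoodRatio (hg : IsPositiveDensity g) {f : ℝ → ℝ} (hf : Measurable f) (n : ℕ) :
    ∫⁻ x, likelihoodRatio g f n x ∂dataLaw g =
      (∫⁻ x in Set.Icc (0 : ℝ) 1, ENNReal.ofReal (f x)) ^ n := by
  unfold likelihoodRatio
  rw [hg.lintegral_prod_dataLaw (φ := fun y => ENNReal.ofReal (f y / g y))
    (hf.div hg.measurable).ennreal_ofReal]
  congr 2 with x
  rw [← ENNReal.ofReal_mul' (hg.pos x).le, div_mul_cancel₀ _ (hg.pos x).ne']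

/-- The endpoints must be excluded: `betaPDFReal` is 0 outside the open interval, and so is the
likelihood of a sample containing an endpoint. -/
lemma ae_mem_Ioo (hg : IsPositiveDensity g) : ∀ᵐ x ∂dataLaw g, ∀ i, x i ∈ Set.Ioo (0 : ℝ) 1 := by
  have := hg.isProbabilityMeasure_densityLaw
  rw [ae_all_iff]
  intro i
  have h : ∀ᵐ y ∂densityLaw g, y ∈ Set.Ioo (0 : ℝ) 1 := by
    refine (withDensity_absolutelyContinuous _ _).ae_le ?_
    rw [Measure.restrict_congr_set Ioo_ae_eq_Icc.symm]
    exact ae_restrict_mem measurableSet_Ioo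
  exact (measurePreserving_eval_infinitePi (fun _ : ℕ => densityLaw g) i).quasiMeasurePreserving.ae h

lemma likelihood_eq_mul (hpos : ∀ x, 0 < g x) {f : ℝ → ℝ} (hf : ∀ x, 0 ≤ f x) (n : ℕ) (x : ℕ → ℝ) :
    likelihood f n x = likelihood g n x * likelihoodRatio g f n x := by
  rw [likelihood, likelihood, likelihoodRatio,
    ← ENNReal.ofReal_prod_of_nonneg fun i _ => div_nonneg (hf _) (hpos _).le,
    ← ENNReal.ofReal_mul (Finset.prod_nonneg fun i _ => (hpos _).le), ← Finset.prod_mul_distrib]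
  congr 1
  exact Finset.prod_congr rfl fun i _ => by rw [mul_div_cancel₀ _ (hpos _).ne']

end IsPositiveDensity

/-! ### Posterior bounds for a general dominated model. -/

section Posterior

variable {Θ : Type*} [MeasurableSpace Θ] {prior : Measure Θ} {f : Θ → ℝ → ℝ} {g : ℝ → ℝ}

lemma likelihood_ne_zero (hpos : ∀ x, 0 < g x) (n : ℕ) (x : ℕ → ℝ) : likelihood g n x ≠ 0 := by
  rw [likelihood, Ne, ENNReal.ofReal_eq_zero, not_le]
  exact Finset.prod_pos fun i _ => hpos _

lemma measurable_uncurry_likelihoodRatio (hg : Measurable g)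
    (hf : Measurable fun q : Θ × ℝ => f q.1 q.2) (n : ℕ) :
    Measurable fun q : Θ × (ℕ → ℝ) => likelihoodRatio g (f q.1) n q.2 := by
  unfold likelihoodRatio
  refine Finset.measurable_prod _ fun i _ => ?_
  have h1 : Measurable fun q : Θ × (ℕ → ℝ) => (q.1, q.2 i) :=
    measurable_fst.prodMk ((measurable_pi_apply i).comp measurable_snd)
  exact ((hf.comp h1).div (hg.comp (measurable_snd.comp h1))).ennreal_ofReal

lemma measurable_uncurry_swap_likelihoodRatio (hg : Measurable g)
    (hf : Measurable fun q : Θ × ℝ => f q.1 q.2) (n : ℕ) :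
    Measurable (Function.uncurry fun (x : ℕ → ℝ) (θ : Θ) => likelihoodRatio g (f θ) n x) :=
  (measurable_uncurry_likelihoodRatio hg hf n).comp measurable_swap

lemma measurable_uncurry_swap_inv_likelihoodRatio (hg : Measurable g)
    (hf : Measurable fun q : Θ × ℝ => f q.1 q.2) (n : ℕ) :
    Measurable (Function.uncurry fun (x : ℕ → ℝ) (θ : Θ) => (likelihoodRatio g (f θ) n x)⁻¹) :=
  (measurable_uncurry_swap_likelihoodRatio hg hf n).inv

/-- The posterior computed with likelihood ratios. -/
lemma posterior_apply [SFinite prior] (hpos : ∀ x, 0 < g x) (hf0 : ∀ θ x, 0 ≤ f θ x) (n : ℕ)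
    (x : ℕ → ℝ) (A : Set Θ) :
    posterior prior f n x A =
      (∫⁻ θ, likelihoodRatio g (f θ) n x ∂prior)⁻¹ * ∫⁻ θ in A, likelihoodRatio g (f θ) n x ∂prior := by
  have h0 := likelihood_ne_zero hpos n x
  have ht : likelihood g n x ≠ ∞ := ENNReal.ofReal_ne_top
  simp only [posterior, Measure.smul_apply, withDensity_apply', smul_eq_mul]
  simp_rw [fun θ => IsPositiveDensity.likelihood_eq_mul hpos (hf0 θ) n x]
  rw [lintegral_const_mul' _ _ ht, lintegral_const_mul' _ _ ht,
    ENNReal.mul_inv (Or.inl h0) (Or.inl ht), mul_mul_mul_comm, mul_comm _⁻¹ (likelihood _ _ _),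
    ENNReal.mul_inv_cancel h0 ht, one_mul]

/-- By Tonelli, since a likelihood ratio has expectation (∫ f)ⁿ ≤ 1. Total mass below 1 is allowed,
as a distribution may charge the complement of (0, 1]. -/
lemma lintegral_lintegral_likelihoodRatio_le [SFinite prior] (hg : IsPositiveDensity g)
    (hf : Measurable fun q : Θ × ℝ => f q.1 q.2)
    (hf1 : ∀ θ, ∫⁻ x in Set.Icc (0 : ℝ) 1, ENNReal.ofReal (f θ x) ≤ 1) (n : ℕ) (V : Set Θ) :
    ∫⁻ x, ∫⁻ θ in V, likelihoodRatio g (f θ) n x ∂prior ∂dataLaw g ≤ prior V := by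
  have := hg.isProbabilityMeasure_dataLaw
  rw [lintegral_lintegral_swap
    (measurable_uncurry_swap_likelihoodRatio hg.measurable hf n).aemeasurable]
  calc _ ≤ ∫⁻ _ in V, 1 ∂prior := lintegral_mono fun θ => by
        rw [hg.lintegral_likelihoodRatio (f := f θ) (hf.comp measurable_prodMk_left)]
        exact pow_le_one₀ (zero_le) (hf1 θ)
    _ = prior V := by simp

/-- The evidence divided by the likelihood of g has expectation at most 1, so it is almost surely
finite. If it vanished, the likelihood would be 0 for almost every parameter, against positivity on
(0, 1). -/
lemma isProbabilityMeasure_posterior [IsProbabilityMeasure prior] (hg : IsPositiveDensity g)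
    (hf : Measurable fun q : Θ × ℝ => f q.1 q.2) (hf0 : ∀ θ x, 0 ≤ f θ x)
    (hf1 : ∀ θ, ∫⁻ x in Set.Icc (0 : ℝ) 1, ENNReal.ofReal (f θ x) ≤ 1)
    (hfpos : ∀ᵐ θ ∂prior, ∀ x ∈ Set.Ioo (0 : ℝ) 1, 0 < f θ x) :
    ∀ᵐ x ∂dataLaw g, ∀ n, IsProbabilityMeasure (posterior prior f n x) := by
  have := hg.isProbabilityMeasure_dataLaw
  have hfin : ∀ᵐ x ∂dataLaw g, ∀ n, ∫⁻ θ, likelihoodRatio g (f θ) n x ∂prior < ∞ := by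
    rw [ae_all_iff]
    intro n
    refine ae_lt_top ?_ ?_
    · exact (measurable_uncurry_swap_likelihoodRatio hg.measurable hf n).lintegral_prod_right
    · have := lintegral_lintegral_likelihoodRatio_le (prior := prior) hg hf hf1 n Set.univ
      rw [Measure.restrict_univ, measure_univ] at this
      exact (this.trans_lt ENNReal.one_lt_top).ne
  filter_upwards [hfin, hg.ae_mem_Ioo] with x hx hxI n
  constructor
  rw [posterior_apply hg.pos hf0, Measure.restrict_univ]
  refine ENNReal.inv_mul_cancel (fun h0 => ?_) (hx n).ne
  have hm : Measurable fun θ => likelihoodRatio g (f θ) n x :=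
    (measurable_uncurry_likelihoodRatio hg.measurable hf n).comp measurable_prodMk_right
  rw [lintegral_eq_zero_iff hm] at h0
  have : ∀ᵐ θ ∂prior, False := by
    filter_upwards [h0, hfpos] with θ h1 h2
    have h3 := Finset.prod_eq_zero_iff.1 (show likelihoodRatio g (f θ) n x = 0 from h1)
    obtain ⟨i, -, hi⟩ := h3
    rw [ENNReal.ofReal_eq_zero] at hi
    exact absurd (div_pos (h2 _ (hxI i)) (hg.pos (x i))) (not_lt.2 hi)
  have h := ae_iff.1 this
  simp at h

lemma le_add_sq_mul_inv {s : ℝ≥0∞} (hs : s ≠ 0) (hs' : s ≠ ∞) (r : ℝ≥0∞) : s ≤ r + s ^ 2 * r⁻¹ := by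
  rcases le_or_gt s r with h | h
  · exact h.trans le_self_add
  · refine le_trans ?_ le_add_self
    calc s = s ^ 2 * s⁻¹ := by rw [pow_two, mul_assoc, ENNReal.mul_inv_cancel hs hs', mul_one]
      _ ≤ s ^ 2 * r⁻¹ := by gcongr

/-- A lower bound on the integral of a function from an upper bound on that of its inverse. -/
lemma lintegral_ge_of_lintegral_inv_le {μ : Measure Θ} [IsFiniteMeasure μ] {r : Θ → ℝ≥0∞}
    (hr : Measurable r) {T : ℝ} (hT : 0 < T) (h : ∫⁻ θ, (r θ)⁻¹ ∂μ ≤ ENNReal.ofReal T * μ Set.univ) :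
    μ Set.univ * ENNReal.ofReal (1 / (4 * T)) ≤ ∫⁻ θ, r θ ∂μ := by
  -- This s maximises s - s² T, with maximum 1 / (4 T).
  set s := ENNReal.ofReal (1 / (2 * T)) with hs
  have hs0 : s ≠ 0 := by
    rw [hs, Ne, ENNReal.ofReal_eq_zero, not_le]; positivity
  have h1 : s * μ Set.univ ≤ ∫⁻ θ, r θ ∂μ + s ^ 2 * (ENNReal.ofReal T * μ Set.univ) := by
    calc s * μ Set.univ = ∫⁻ _, s ∂μ := by simp
      _ ≤ ∫⁻ θ, (r θ + s ^ 2 * (r θ)⁻¹) ∂μ :=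
          lintegral_mono fun θ => le_add_sq_mul_inv hs0 ENNReal.ofReal_ne_top _
      _ = ∫⁻ θ, r θ ∂μ + s ^ 2 * ∫⁻ θ, (r θ)⁻¹ ∂μ := by
          rw [lintegral_add_left hr, lintegral_const_mul' _ _ (ENNReal.pow_ne_top ENNReal.ofReal_ne_top)]
      _ ≤ _ := by gcongr
  have e1 : s ^ 2 * (ENNReal.ofReal T * μ Set.univ) = μ Set.univ * ENNReal.ofReal (1 / (4 * T)) := by
    rw [hs, ← mul_assoc, ← ENNReal.ofReal_pow (by positivity), ← ENNReal.ofReal_mul (by positivity),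
      mul_comm]
    congr 2
    field_simp
    norm_num
  have e2 : s * μ Set.univ =
      μ Set.univ * ENNReal.ofReal (1 / (4 * T)) + μ Set.univ * ENNReal.ofReal (1 / (4 * T)) := by
    rw [← mul_add, ← ENNReal.ofReal_add (by positivity) (by positivity), mul_comm, hs]
    congr 2
    field_simp
    norm_num
  rw [e1, e2] at h1
  exact (ENNReal.add_le_add_iff_right
    (ENNReal.mul_ne_top (measure_ne_top _ _) ENNReal.ofReal_ne_top)).1 h1

lemma inv_likelihoodRatio (h : ℝ → ℝ) (n : ℕ) (x : ℕ → ℝ) :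
    (likelihoodRatio g h n x)⁻¹ = ∏ i ∈ Finset.range n, (ENNReal.ofReal (h (x i) / g (x i)))⁻¹ := by
  rw [likelihoodRatio, ENNReal.prod_inv_distrib]
  exact fun _ _ _ _ _ => Or.inr ENNReal.ofReal_ne_top

/-- The inverse ratio has as expectation the n-th power of ∫ g²/f, so a chi-square bound on U
controls the evidence without logarithms or variances. -/
lemma lintegral_lintegral_inv_likelihoodRatio_le [SFinite prior] (hg : IsPositiveDensity g)
    (hf : Measurable fun q : Θ × ℝ => f q.1 q.2) {U : Set Θ} (hU : MeasurableSet U) {q : ℝ≥0∞}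
    (hq : ∀ θ ∈ U, ∫⁻ x in Set.Icc (0 : ℝ) 1,
      (ENNReal.ofReal (f θ x / g x))⁻¹ * ENNReal.ofReal (g x) ≤ q) (n : ℕ) :
    ∫⁻ x, ∫⁻ θ in U, (likelihoodRatio g (f θ) n x)⁻¹ ∂prior ∂dataLaw g ≤ q ^ n * prior U := by
  have := hg.isProbabilityMeasure_dataLaw
  rw [lintegral_lintegral_swap
    (measurable_uncurry_swap_inv_likelihoodRatio hg.measurable hf n).aemeasurable]
  calc _ ≤ ∫⁻ _ in U, q ^ n ∂prior := setLIntegral_mono' hU fun θ hθ => by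
        simp only [inv_likelihoodRatio]
        rw [hg.lintegral_prod_dataLaw (φ := fun y => (ENNReal.ofReal (f θ y / g y))⁻¹)
          ((hf.comp measurable_prodMk_left).div hg.measurable).ennreal_ofReal.inv]
        gcongr
        exact hq θ hθ
    _ = _ := by simp

/-- Exponential bound on the probability that the likelihood ratio of `u` is not small. -/
lemma dataLaw_likelihoodRatio_ge_le (hg : IsPositiveDensity g) {u : ℝ → ℝ} (hu : Measurable u)
    {ρ : ℝ≥0∞} (hρ : ∫⁻ x in Set.Icc (0 : ℝ) 1, ENNReal.ofReal (√(u x * g x)) ≤ ρ) (n : ℕ) (b : ℝ) :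
    dataLaw g {x | ENNReal.ofReal (Real.exp (-(2 * b))) ≤ likelihoodRatio g u n x} ≤
      ENNReal.ofReal (Real.exp b) * ρ ^ n := by
  have hm : Measurable fun y => ENNReal.ofReal (√(u y / g y)) :=
    (hu.div hg.measurable).sqrt.ennreal_ofReal
  have hmp : Measurable fun x : ℕ → ℝ => ∏ i ∈ Finset.range n, ENNReal.ofReal (√(u (x i) / g (x i))) :=
    Finset.measurable_prod _ fun i _ => hm.comp (measurable_pi_apply i)
  -- Markov's inequality is applied to the square root of the ratio, whose expectation is the n-th
  -- power of the affinity ∫ √(u g).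
  have hsub : {x | ENNReal.ofReal (Real.exp (-(2 * b))) ≤ likelihoodRatio g u n x} ⊆
      {x | ENNReal.ofReal (Real.exp (-b)) ≤
        ∏ i ∈ Finset.range n, ENNReal.ofReal (√(u (x i) / g (x i)))} := by
    intro x hx
    have e : likelihoodRatio g u n x ≤
        (∏ i ∈ Finset.range n, ENNReal.ofReal (√(u (x i) / g (x i)))) ^ 2 := by
      rw [likelihoodRatio, ← Finset.prod_pow]
      refine Finset.prod_le_prod' fun i _ => ?_
      rw [← ENNReal.ofReal_pow (Real.sqrt_nonneg _)]
      refine ENNReal.ofReal_le_ofReal ?_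
      rcases le_total 0 (u (x i) / g (x i)) with h | h
      · exact (Real.sq_sqrt h).ge
      · exact h.trans (sq_nonneg _)
    have e' : ENNReal.ofReal (Real.exp (-(2 * b))) = ENNReal.ofReal (Real.exp (-b)) ^ 2 := by
      rw [← ENNReal.ofReal_pow (Real.exp_nonneg _), ← Real.exp_nat_mul]
      congr 2; push_cast; ring
    have hx' : ENNReal.ofReal (Real.exp (-(2 * b))) ≤ likelihoodRatio g u n x := hx
    have := hx'.trans e
    rw [e'] at this
    exact (ENNReal.pow_le_pow_left_iff two_ne_zero).1 this
  refine (measure_mono hsub).trans ?_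
  refine (meas_ge_le_lintegral_div hmp.aemeasurable (by simp [Real.exp_pos]) ENNReal.ofReal_ne_top).trans ?_
  rw [hg.lintegral_prod_dataLaw hm, ENNReal.div_eq_inv_mul, ← ENNReal.ofReal_inv_of_pos (Real.exp_pos _),
    ← Real.exp_neg, neg_neg]
  gcongr
  refine le_trans (le_of_eq ?_) hρ
  congr 1 with x
  rw [← ENNReal.ofReal_mul (Real.sqrt_nonneg _)]
  congr 1
  have hgx := hg.pos x
  rw [Real.sqrt_div' _ hgx.le, Real.sqrt_mul' _ hgx.le, div_mul_eq_mul_div, div_eq_iff (by positivity),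
    mul_assoc, Real.mul_self_sqrt hgx.le]

/-- Finite-sample bound on the posterior mass of a set `A` of parameters that is covered by a set
`V` of small prior mass and by finitely many brackets. -/
theorem dataLaw_posterior_gt_le [IsProbabilityMeasure prior] (hg : IsPositiveDensity g)
    (hf : Measurable fun q : Θ × ℝ => f q.1 q.2) (hf0 : ∀ θ x, 0 ≤ f θ x)
    (hf1 : ∀ θ, ∫⁻ x in Set.Icc (0 : ℝ) 1, ENNReal.ofReal (f θ x) ≤ 1)
    {U V A : Set Θ} (hU : MeasurableSet U) (hU0 : prior U ≠ 0) {q : ℝ≥0∞}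
    (hq : ∀ θ ∈ U, ∫⁻ x in Set.Icc (0 : ℝ) 1,
      (ENNReal.ofReal (f θ x / g x))⁻¹ * ENNReal.ofReal (g x) ≤ q)
    {ι : Type*} (F : Finset ι) {u : ι → ℝ → ℝ} (hu : ∀ i, Measurable (u i)) {ρ : ℝ≥0∞}
    (hρ : ∀ i ∈ F, ∫⁻ x in Set.Icc (0 : ℝ) 1, ENNReal.ofReal (√(u i x * g x)) ≤ ρ)
    (hA : ∀ θ ∈ A, θ ∈ V ∨ ∃ i ∈ F, ∀ y, f θ y ≤ u i y) (n : ℕ) (t b d : ℝ) :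
    dataLaw g {x | (prior U)⁻¹ * ENNReal.ofReal (4 * Real.exp t) *
        (ENNReal.ofReal (Real.exp (-d)) + ENNReal.ofReal (Real.exp (-(2 * b)))) <
          posterior prior f n x A} ≤
      ENNReal.ofReal (Real.exp (-t)) * q ^ n + ENNReal.ofReal (Real.exp d) * prior V +
        F.card * (ENNReal.ofReal (Real.exp b) * ρ ^ n) := by
  have := hg.isProbabilityMeasure_dataLaw
  have hmeas := measurable_uncurry_likelihoodRatio hg.measurable hf n
  -- The three bad events: small evidence (E₁), large likelihood mass on V (E₂), some bracket with a
  -- large ratio (E₃). Off their union the posterior bound is deterministic.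
  set E₁ : Set (ℕ → ℝ) := {x | ENNReal.ofReal (Real.exp t) * prior U ≤
    ∫⁻ θ in U, (likelihoodRatio g (f θ) n x)⁻¹ ∂prior} with hE₁
  set E₂ : Set (ℕ → ℝ) := {x | ENNReal.ofReal (Real.exp (-d)) ≤
    ∫⁻ θ in V, likelihoodRatio g (f θ) n x ∂prior} with hE₂
  set E₃ : Set (ℕ → ℝ) := ⋃ i ∈ F, {x | ENNReal.ofReal (Real.exp (-(2 * b))) ≤
    likelihoodRatio g (u i) n x} with hE₃
  have h₁ : dataLaw g E₁ ≤ ENNReal.ofReal (Real.exp (-t)) * q ^ n := by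
    refine (meas_ge_le_lintegral_div (measurable_uncurry_swap_inv_likelihoodRatio hg.measurable hf n).lintegral_prod_right.aemeasurable
      (mul_ne_zero (by simp [Real.exp_pos]) hU0)
      (ENNReal.mul_ne_top ENNReal.ofReal_ne_top (measure_ne_top _ _))).trans ?_
    refine ENNReal.div_le_of_le_mul ?_
    refine (lintegral_lintegral_inv_likelihoodRatio_le hg hf hU hq n).trans (le_of_eq ?_)
    rw [mul_mul_mul_comm, ← ENNReal.ofReal_mul (Real.exp_nonneg _), ← Real.exp_add]
    simp
  have h₂ : dataLaw g E₂ ≤ ENNReal.ofReal (Real.exp d) * prior V := by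
    refine (meas_ge_le_lintegral_div (measurable_uncurry_swap_likelihoodRatio hg.measurable hf n).lintegral_prod_right.aemeasurable
      (by simp [Real.exp_pos]) ENNReal.ofReal_ne_top).trans ?_
    rw [ENNReal.div_eq_inv_mul, ← ENNReal.ofReal_inv_of_pos (Real.exp_pos _), ← Real.exp_neg, neg_neg]
    gcongr
    exact lintegral_lintegral_likelihoodRatio_le hg hf hf1 n V
  have h₃ : dataLaw g E₃ ≤ F.card * (ENNReal.ofReal (Real.exp b) * ρ ^ n) := by
    refine (measure_biUnion_finset_le _ _).trans ?_
    refine (Finset.sum_le_sum fun i hi => dataLaw_likelihoodRatio_ge_le hg (hu i) (hρ i hi) n b).trans ?_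
    simp
  have hsub : {x | (prior U)⁻¹ * ENNReal.ofReal (4 * Real.exp t) *
      (ENNReal.ofReal (Real.exp (-d)) + ENNReal.ofReal (Real.exp (-(2 * b)))) <
        posterior prior f n x A} ⊆ E₁ ∪ E₂ ∪ E₃ := by
    intro x hx
    by_contra hne
    simp only [Set.mem_union, not_or] at hne
    obtain ⟨⟨hx₁, hx₂⟩, hx₃⟩ := hne
    have hm : Measurable fun θ => likelihoodRatio g (f θ) n x := hmeas.comp measurable_prodMk_right
    rw [Set.mem_ofPred_eq, ← not_le] at hx
    refine hx ?_
    rw [posterior_apply hg.pos hf0]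
    refine mul_le_mul' ?_ ?_
    · have h := lintegral_ge_of_lintegral_inv_le (μ := prior.restrict U) hm (Real.exp_pos t) (by
        rw [Measure.restrict_apply_univ]; exact (not_le.1 hx₁).le)
      rw [Measure.restrict_apply_univ] at h
      have h' := ENNReal.inv_le_inv.2 (h.trans (setLIntegral_le_lintegral U _))
      refine h'.trans (le_of_eq ?_)
      rw [ENNReal.mul_inv (Or.inl hU0) (Or.inl (measure_ne_top _ _)),
        ← ENNReal.ofReal_inv_of_pos (by positivity), one_div, inv_inv]
    -- Off E₃, each θ in A has f θ below a bracket of small ratio, or lies in V. The measurable set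
    -- B stands in for the part of A outside V, as A need not be measurable.
    · set B := {θ | likelihoodRatio g (f θ) n x ≤ ENNReal.ofReal (Real.exp (-(2 * b)))} with hB
      have hBm : MeasurableSet B := measurableSet_le hm measurable_const
      have hAVB : A ⊆ V ∪ B := by
        intro θ hθ
        rcases hA θ hθ with h | ⟨i, hi, h⟩
        · exact Or.inl h
        · right
          have h3 : ¬ ENNReal.ofReal (Real.exp (-(2 * b))) ≤ likelihoodRatio g (u i) n x := fun h' =>
            hx₃ (Set.mem_biUnion hi h')
          refine le_trans ?_ (not_le.1 h3).le
          refine Finset.prod_le_prod' fun j _ => ENNReal.ofReal_le_ofReal ?_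
          have := hg.pos (x j)
          gcongr
          exact h _
      calc _ ≤ ∫⁻ θ in V ∪ B, likelihoodRatio g (f θ) n x ∂prior := lintegral_mono_set hAVB
        _ ≤ ∫⁻ θ in V, likelihoodRatio g (f θ) n x ∂prior +
            ∫⁻ θ in B, likelihoodRatio g (f θ) n x ∂prior := lintegral_union_le _ _ _
        _ ≤ _ := by
          refine add_le_add (not_le.1 hx₂).le ?_
          refine (setLIntegral_mono' hBm fun θ hθ => (hθ : _ ≤ _)).trans ?_
          rw [setLIntegral_const]
          exact mul_le_of_le_one_right' prob_le_one
  calc _ ≤ dataLaw g (E₁ ∪ E₂ ∪ E₃) := measure_mono hsub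
    _ ≤ dataLaw g E₁ + dataLaw g E₂ + dataLaw g E₃ :=
        (measure_union_le _ _).trans (add_le_add_left (measure_union_le _ _) _)
    _ ≤ _ := add_le_add (add_le_add h₁ h₂) h₃

end Posterior

/-! ### Chi-square neighbourhoods and upper brackets for Bernstein densities. -/

lemma setLIntegral_betaMixture {k : ℕ} {w : ℕ → ℝ} (hw : ∀ j ∈ Finset.Icc 1 k, 0 ≤ w j) :
    ∫⁻ x in Set.Icc (0 : ℝ) 1, ENNReal.ofReal (betaMixture k w x) =
      ENNReal.ofReal (∑ j ∈ Finset.Icc 1 k, w j) := by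
  rw [← ofReal_integral_eq_lintegral_ofReal (integrableOn_betaMixture k w)
    (ae_of_all _ fun x => betaMixture_nonneg hw x), setIntegral_betaMixture]

lemma bernsteinModel_eq (θ : ℕ × ProbabilityMeasure ℝ) :
    bernsteinModel θ = betaMixture θ.1 (cellMass θ.1 θ.2) :=
  bernsteinDensity_eq_betaMixture _ _

lemma bernsteinModel_nonneg (θ : ℕ × ProbabilityMeasure ℝ) (x : ℝ) : 0 ≤ bernsteinModel θ x := by
  rw [bernsteinModel_eq]
  exact betaMixture_nonneg (fun j _ => cellMass_nonneg _ _ j) x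

lemma setLIntegral_bernsteinModel_le (θ : ℕ × ProbabilityMeasure ℝ) :
    ∫⁻ x in Set.Icc (0 : ℝ) 1, ENNReal.ofReal (bernsteinModel θ x) ≤ 1 := by
  rw [bernsteinModel_eq, setLIntegral_betaMixture fun j _ => cellMass_nonneg _ _ j]
  exact ENNReal.ofReal_le_one.2 (sum_cellMass_le_one _ _)

lemma bernsteinDensity_pos {k : ℕ} (hk : k ≠ 0) {P : ProbabilityMeasure ℝ}
    (hP : (P : Measure ℝ).real (Set.Ioc 0 1) = 1) {x : ℝ} (hx : x ∈ Set.Ioo (0 : ℝ) 1) :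
    0 < bernsteinDensity k P x := by
  rw [bernsteinDensity_eq_betaMixture]
  rw [← sum_cellMass hk] at hP
  have hpos : ∀ j ∈ Finset.Icc 1 k, 0 < betaPDFReal (j : ℝ) ((k : ℝ) - j + 1) x := fun j hj =>
    betaPDFReal_pos hx.1 hx.2 (beta_parameter_pos hj).1 (beta_parameter_pos hj).2
  obtain ⟨j, hj, hj0⟩ := Finset.exists_ne_zero_of_sum_ne_zero (hP.trans_ne one_ne_zero)
  exact Finset.sum_pos' (fun i hi => mul_nonneg (cellMass_nonneg k P i) (hpos i hi).le)
    ⟨j, hj, mul_pos ((cellMass_nonneg k P j).lt_of_ne' hj0) (hpos j hj)⟩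

/-- Chi-square bound for a density `f` uniformly close to `g`. -/
lemma lintegral_inv_ratio_le {f g : ℝ → ℝ} {c δ : ℝ} (hg : IsPositiveDensity g) (hc : 0 < c)
    (hgc : ∀ x, c ≤ g x) (hf : IntegrableOn f (Set.Icc 0 1))
    (hf1 : ∫ x in Set.Icc (0 : ℝ) 1, f x = 1)
    (hδ : ∀ x ∈ Set.Ioo (0 : ℝ) 1, |f x - g x| ≤ δ) (hδc : δ ≤ c / 2) :
    ∫⁻ x in Set.Icc (0 : ℝ) 1, (ENNReal.ofReal (f x / g x))⁻¹ * ENNReal.ofReal (g x) ≤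
      ENNReal.ofReal (1 + 2 / c * δ ^ 2) := by
  have hpt : ∀ x ∈ Set.Ioo (0 : ℝ) 1, 0 < f x ∧
      g x * g x / f x ≤ 2 * g x - f x + 2 / c * δ ^ 2 := by
    intro x hx
    have h := hδ x hx
    have hsq : (f x - g x) ^ 2 ≤ δ ^ 2 := sq_le_sq' (neg_le_of_abs_le h) (le_of_abs_le h)
    rw [abs_le] at h
    have hfx : c / 2 ≤ f x := by linarith [hgc x]
    have hfx0 : 0 < f x := by linarith
    refine ⟨hfx0, ?_⟩
    -- As 2 g - f integrates to 1, the excess over 1 is quadratic in δ. This needs ∫ f to be exactly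
    -- 1.
    have e : g x * g x / f x = 2 * g x - f x + (f x - g x) ^ 2 / f x := by field_simp; ring
    rw [e]
    have : (f x - g x) ^ 2 / f x ≤ δ ^ 2 / (c / 2) := by gcongr
    have e2 : δ ^ 2 / (c / 2) = 2 / c * δ ^ 2 := by field_simp
    linarith
  have hint : IntegrableOn (fun x => 2 * g x - f x + 2 / c * δ ^ 2) (Set.Icc 0 1) :=
    ((hg.integrableOn.const_mul 2).sub hf).add (integrable_const _)
  have hgf : IntegrableOn (fun x => 2 * g x - f x) (Set.Icc 0 1) :=
    (hg.integrableOn.const_mul 2).sub hf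
  have hIoo : ∀ᵐ x ∂(volume.restrict (Set.Icc (0 : ℝ) 1)), x ∈ Set.Ioo (0 : ℝ) 1 := by
    rw [Measure.restrict_congr_set Ioo_ae_eq_Icc.symm]
    exact ae_restrict_mem measurableSet_Ioo
  calc _ ≤ ∫⁻ x in Set.Icc (0 : ℝ) 1, ENNReal.ofReal (2 * g x - f x + 2 / c * δ ^ 2) := by
        refine lintegral_mono_ae ?_
        filter_upwards [hIoo] with x hx
        obtain ⟨h0, h1⟩ := hpt x hx
        have hgx := hg.pos x
        rw [← ENNReal.ofReal_inv_of_pos (by positivity), ← ENNReal.ofReal_mul (by positivity)]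
        refine ENNReal.ofReal_le_ofReal (le_trans (le_of_eq ?_) h1)
        field_simp
    _ = ENNReal.ofReal (∫ x in Set.Icc (0 : ℝ) 1, (2 * g x - f x + 2 / c * δ ^ 2)) := by
        refine (ofReal_integral_eq_lintegral_ofReal hint ?_).symm
        filter_upwards [hIoo] with x hx
        obtain ⟨h0, h1⟩ := hpt x hx
        have hgx := hg.pos x
        exact le_trans (by positivity) h1
    _ ≤ _ := by
        refine ENNReal.ofReal_le_ofReal (le_of_eq ?_)
        rw [integral_add hgf (integrable_const _),
          integral_sub (hg.integrableOn.const_mul 2) hf, integral_const_mul, hg.integral_eq_one, hf1]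
        simp
        norm_num

/-- Split √(u g) ≤ √(f g) + √((u - f) g): the first term is the Hellinger affinity, the second is
bounded by the arithmetic-geometric mean inequality with weight τ. If u - f has integral at most τ²,
the second integrates to at most τ. -/
lemma sqrt_mul_le {f g u τ : ℝ} (hf : 0 ≤ f) (hg : 0 ≤ g) (hu : f ≤ u) (hτ : 0 < τ) :
    √(u * g) ≤ (f + g - (√f - √g) ^ 2) / 2 + ((u - f) / τ + τ * g) / 2 := by
  have h1 : √(u * g) ≤ √(f * g) + √((u - f) * g) := by
    refine Real.sqrt_le_iff.2 ⟨by positivity, ?_⟩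
    rw [add_sq, Real.sq_sqrt (mul_nonneg hf hg), Real.sq_sqrt (mul_nonneg (sub_nonneg.2 hu) hg)]
    nlinarith [mul_nonneg (Real.sqrt_nonneg (f * g)) (Real.sqrt_nonneg ((u - f) * g))]
  have h2 : √(f * g) = (f + g - (√f - √g) ^ 2) / 2 := by
    rw [Real.sqrt_mul hf, sub_sq, Real.sq_sqrt hf, Real.sq_sqrt hg]; ring
  have h3 : √((u - f) * g) ≤ ((u - f) / τ + τ * g) / 2 := by
    have hd : 0 ≤ (u - f) / τ := div_nonneg (sub_nonneg.2 hu) hτ.le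
    have hτg : 0 ≤ τ * g := by positivity
    refine Real.sqrt_le_iff.2 ⟨by positivity, ?_⟩
    have : (u - f) * g = (u - f) / τ * (τ * g) := by field_simp
    rw [this]
    nlinarith [sq_nonneg ((u - f) / τ - τ * g)]
  linarith

/-- The affinity of `g` and an upper bracket of `f` is controlled by the Hellinger distance. -/
lemma lintegral_sqrt_mul_le {f g u : ℝ → ℝ} {τ : ℝ} (hg : IsPositiveDensity g)
    (hfm : Measurable f) (hf0 : ∀ x, 0 ≤ f x) (hf : IntegrableOn f (Set.Icc 0 1))
    (hf1 : ∫ x in Set.Icc (0 : ℝ) 1, f x ≤ 1) (hu : IntegrableOn u (Set.Icc 0 1))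
    (hfu : ∀ x, f x ≤ u x) (hτ : 0 < τ)
    (huf : ∫ x in Set.Icc (0 : ℝ) 1, (u x - f x) ≤ τ ^ 2) :
    ∫⁻ x in Set.Icc (0 : ℝ) 1, ENNReal.ofReal (√(u x * g x)) ≤
      ENNReal.ofReal (1 - hellinger f g ^ 2 / 2 + τ) := by
  have hsq : IntegrableOn (fun x => (√(f x) - √(g x)) ^ 2) (Set.Icc 0 1) := by
    refine Integrable.mono' (hf.add hg.integrableOn)
      ((hfm.sqrt.sub hg.measurable.sqrt).pow_const 2).aestronglyMeasurable (ae_of_all _ fun x => ?_)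
    rw [Real.norm_eq_abs, abs_of_nonneg (sq_nonneg _), sub_sq, Real.sq_sqrt (hf0 x),
      Real.sq_sqrt (hg.pos x).le, Pi.add_apply]
    nlinarith [mul_nonneg (Real.sqrt_nonneg (f x)) (Real.sqrt_nonneg (g x))]
  have hh : hellinger f g ^ 2 = ∫ x in Set.Icc (0 : ℝ) 1, (√(f x) - √(g x)) ^ 2 :=
    Real.sq_sqrt (integral_nonneg fun x => sq_nonneg _)
  have hI1 : IntegrableOn (fun x => (f x + g x - (√(f x) - √(g x)) ^ 2) / 2) (Set.Icc 0 1) :=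
    ((hf.add hg.integrableOn).sub hsq).div_const 2
  have hI2 : IntegrableOn (fun x => ((u x - f x) / τ + τ * g x) / 2) (Set.Icc 0 1) :=
    (((hu.sub hf).div_const τ).add (hg.integrableOn.const_mul τ)).div_const 2
  have hfg : IntegrableOn (fun x => f x + g x) (Set.Icc 0 1) := hf.add hg.integrableOn
  have huf' : IntegrableOn (fun x => (u x - f x) / τ) (Set.Icc 0 1) := (hu.sub hf).div_const τ
  calc _ ≤ ∫⁻ x in Set.Icc (0 : ℝ) 1, ENNReal.ofReal
          ((f x + g x - (√(f x) - √(g x)) ^ 2) / 2 + ((u x - f x) / τ + τ * g x) / 2) :=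
        lintegral_mono fun x => ENNReal.ofReal_le_ofReal
          (sqrt_mul_le (hf0 x) (hg.pos x).le (hfu x) hτ)
    _ = ENNReal.ofReal (∫ x in Set.Icc (0 : ℝ) 1,
          ((f x + g x - (√(f x) - √(g x)) ^ 2) / 2 + ((u x - f x) / τ + τ * g x) / 2)) :=
        (ofReal_integral_eq_lintegral_ofReal (hI1.add hI2) (ae_of_all _ fun x =>
          (Real.sqrt_nonneg _).trans (sqrt_mul_le (hf0 x) (hg.pos x).le (hfu x) hτ))).symm
    _ ≤ _ := by
        refine ENNReal.ofReal_le_ofReal ?_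
        rw [integral_add hI1 hI2, integral_div, integral_div,
          integral_sub hfg hsq, integral_add hf hg.integrableOn,
          integral_add huf' (hg.integrableOn.const_mul τ), integral_div,
          integral_const_mul, hg.integral_eq_one, ← hh]
        have : (∫ x in Set.Icc (0 : ℝ) 1, (u x - f x)) / τ ≤ τ := by
          rw [div_le_iff₀ hτ, ← pow_two]; exact huf
        linarith

/-- Coefficients on the grid of mesh `1 / G`. -/
def gridCoeff {K G : ℕ} (m : Fin K → Fin (G + 1)) (j : ℕ) : ℝ :=
  if h : j - 1 < K then ((m ⟨j - 1, h⟩ : ℕ) : ℝ) / G else 0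

/-- Rounding up makes the grid mixture an upper bracket; only its upper envelope matters, so it need
not integrate to 1. -/
lemma exists_gridCoeff {k K G : ℕ} (hk : k ≤ K) (hG : 0 < G) {w : ℕ → ℝ} (hw0 : ∀ j, 0 ≤ w j)
    (hw1 : ∀ j, w j ≤ 1) : ∃ m : Fin K → Fin (G + 1), ∀ j ∈ Finset.Icc 1 k,
      w j ≤ gridCoeff m j ∧ gridCoeff m j ≤ w j + 1 / G := by
  have hG' : (0 : ℝ) < G := by exact_mod_cast hG
  have hle : ∀ j, ⌈w j * G⌉₊ ≤ G := fun j => Nat.ceil_le.2 (mul_le_of_le_one_left hG'.le (hw1 j))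
  refine ⟨fun i => ⟨⌈w (i + 1) * G⌉₊, Nat.lt_succ_of_le (hle _)⟩, fun j hj => ?_⟩
  rw [Finset.mem_Icc] at hj
  have h : j - 1 < K := by omega
  have e : j - 1 + 1 = j := by omega
  simp only [gridCoeff, dif_pos h, e]
  rw [le_div_iff₀ hG', div_le_iff₀ hG', add_mul, one_div, inv_mul_cancel₀ hG'.ne']
  exact ⟨Nat.le_ceil _, (Nat.ceil_lt_add_one (mul_nonneg (hw0 j) hG'.le)).le⟩

instance isProbabilityMeasure_bernsteinPrior (p : PMF ℕ) (D : Measure (ProbabilityMeasure ℝ))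
    [IsProbabilityMeasure D] : IsProbabilityMeasure (bernsteinPrior p D) := by
  unfold bernsteinPrior
  infer_instance

/-- Finite-sample bound on the posterior mass, under the random Bernstein polynomial prior, of the
complement of a Hellinger ball. -/
theorem dataLaw_bernstein_posterior_gt_le {g : ℝ → ℝ} (hg : IsPositiveDensity g) (p : PMF ℕ)
    {D : Measure (ProbabilityMeasure ℝ)} [IsProbabilityMeasure D]
    {U : Set (ℕ × ProbabilityMeasure ℝ)} (hU : MeasurableSet U) (hU0 : bernsteinPrior p D U ≠ 0)
    {q : ℝ≥0∞} (hq : ∀ θ ∈ U, ∫⁻ x in Set.Icc (0 : ℝ) 1,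
      (ENNReal.ofReal (bernsteinModel θ x / g x))⁻¹ * ENNReal.ofReal (g x) ≤ q)
    {K G : ℕ} (hG : 0 < G) {τ r : ℝ} (hτ : 0 < τ) (hKG : (K : ℝ) / G ≤ τ ^ 2) (hr : 0 ≤ r)
    (n : ℕ) (t b d : ℝ) :
    dataLaw g {x | (bernsteinPrior p D U)⁻¹ * ENNReal.ofReal (4 * Real.exp t) *
        (ENNReal.ofReal (Real.exp (-d)) + ENNReal.ofReal (Real.exp (-(2 * b)))) <
          posterior (bernsteinPrior p D) bernsteinModel n x {θ | r < hellinger (bernsteinModel θ) g}} ≤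
      ENNReal.ofReal (Real.exp (-t)) * q ^ n +
        ENNReal.ofReal (Real.exp d) * bernsteinPrior p D {θ | K < θ.1} +
        ((K + 1) * (G + 1) ^ K : ℕ) *
          (ENNReal.ofReal (Real.exp b) * ENNReal.ofReal (1 - r ^ 2 / 2 + τ) ^ n) := by
  classical
  have hG' : (0 : ℝ) < G := by exact_mod_cast hG
  let u : Fin (K + 1) × (Fin K → Fin (G + 1)) → ℝ → ℝ := fun i => betaMixture i.1 (gridCoeff i.2)
  -- Only codes that bracket some density outside the Hellinger ball are kept; that density supplies
  -- the affinity bound for its bracket.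
  let F : Finset (Fin (K + 1) × (Fin K → Fin (G + 1))) := Finset.univ.filter fun i =>
    ∃ θ : ℕ × ProbabilityMeasure ℝ, r < hellinger (bernsteinModel θ) g ∧ θ.1 = i.1 ∧
      ∀ j ∈ Finset.Icc 1 θ.1, cellMass θ.1 θ.2 j ≤ gridCoeff i.2 j ∧
        gridCoeff i.2 j ≤ cellMass θ.1 θ.2 j + 1 / G
  have hF : F.card ≤ (K + 1) * (G + 1) ^ K := by
    refine (Finset.card_le_univ F).trans (le_of_eq ?_)
    simp
  have hρ : ∀ i ∈ F, ∫⁻ x in Set.Icc (0 : ℝ) 1, ENNReal.ofReal (√(u i x * g x)) ≤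
      ENNReal.ofReal (1 - r ^ 2 / 2 + τ) := by
    intro i hi
    obtain ⟨θ, hθ, hk, hj⟩ := (Finset.mem_filter.1 hi).2
    have hui : u i = betaMixture θ.1 (gridCoeff i.2) := by simp only [u, hk]
    have hm := bernsteinModel_eq θ
    have hkK : (θ.1 : ℝ) ≤ K := by
      rw [hk]; exact_mod_cast Nat.lt_succ_iff.1 i.1.2
    refine (lintegral_sqrt_mul_le (f := bernsteinModel θ) (u := u i) hg ?_ (bernsteinModel_nonneg θ)
      ?_ ?_ ?_ ?_ hτ ?_).trans (ENNReal.ofReal_le_ofReal ?_)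
    · rw [hm]; exact measurable_betaMixture _ _
    · rw [hm]; exact integrableOn_betaMixture _ _
    · rw [hm, setIntegral_betaMixture]; exact sum_cellMass_le_one _ _
    · rw [hui]; exact integrableOn_betaMixture _ _
    · rw [hm, hui]; exact betaMixture_mono fun j h => (hj j h).1
    · rw [hm, hui]
      simp only [betaMixture_sub]
      rw [setIntegral_betaMixture]
      calc _ ≤ ∑ j ∈ Finset.Icc 1 θ.1, (1 : ℝ) / G :=
            Finset.sum_le_sum fun j h => by linarith [(hj j h).2]
        _ = θ.1 / G := by simp [div_eq_mul_inv]
        _ ≤ K / G := by gcongr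
        _ ≤ _ := hKG
    · have : r ^ 2 ≤ hellinger (bernsteinModel θ) g ^ 2 := by gcongr
      linarith
  refine (dataLaw_posterior_gt_le (V := {θ | K < θ.1}) hg measurable_uncurry_bernsteinModel
    bernsteinModel_nonneg setLIntegral_bernsteinModel_le hU hU0 hq F (u := u)
    (fun i => measurable_betaMixture _ _) hρ ?_ n t b d).trans ?_
  · intro θ hθ
    rcases lt_or_ge K θ.1 with h | h
    · exact Or.inl h
    · right
      obtain ⟨m, hm⟩ := exists_gridCoeff h hG (w := cellMass θ.1 θ.2) (cellMass_nonneg _ _)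
        (cellMass_le_one _ _)
      refine ⟨(⟨θ.1, Nat.lt_succ_of_le h⟩, m), Finset.mem_filter.2 ⟨Finset.mem_univ _, θ, hθ, rfl, hm⟩,
        fun y => ?_⟩
      rw [bernsteinModel_eq]
      exact betaMixture_mono (fun j hj => (hm j hj).1) y
  · gcongr

/-! ### Tails and small balls of the random Bernstein prior. -/

section Prior

variable {α : Measure ℝ} {D : Measure (ProbabilityMeasure ℝ)} {p : PMF ℕ}

lemma ae_bernsteinModel_pos (hα : α (Set.Ioc 0 1)ᶜ = 0) (hD : IsDirichletProcess α D) (hp : p 0 = 0) :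
    ∀ᵐ θ ∂bernsteinPrior p D, ∀ x ∈ Set.Ioo (0 : ℝ) 1, 0 < bernsteinModel θ x := by
  have := hD.isProbabilityMeasure
  have h1 : ∀ᵐ k ∂p.toMeasure, k ≠ 0 := by
    rw [ae_iff]
    simp [PMF.toMeasure_apply_singleton, hp]
  have h2 := (Measure.quasiMeasurePreserving_fst (μ := p.toMeasure) (ν := D)).ae h1
  have h3 := (Measure.quasiMeasurePreserving_snd (μ := p.toMeasure) (ν := D)).ae
    (ae_real_Ioc_eq_one hα hD)
  unfold bernsteinPrior
  filter_upwards [h2, h3] with θ hk hP x hx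
  exact bernsteinDensity_pos hk hP hx

/-- The prior mass of the orders above `K`. -/
lemma exists_bernsteinPrior_tail_le [IsProbabilityMeasure D]
    (hp_up : ∀ᶠ k : ℕ in atTop, (p k).toReal ≤ Real.exp (-4 * k * Real.log k)) :
    ∃ C : ℝ, 0 < C ∧ ∀ᶠ K : ℕ in atTop,
      bernsteinPrior p D {θ | K < θ.1} ≤ ENNReal.ofReal (C * Real.exp (-2 * K * Real.log K)) := by
  have hsum : Summable fun k : ℕ => Real.exp (-k) := Real.summable_exp_neg_nat
  refine ⟨∑' k : ℕ, Real.exp (-k), hsum.tsum_pos (fun k => (Real.exp_pos _).le) 0 (Real.exp_pos _), ?_⟩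
  obtain ⟨k₀, hk₀⟩ := eventually_atTop.1 hp_up
  filter_upwards [eventually_ge_atTop k₀, eventually_ge_atTop 3] with K hK hK3
  have hset : {θ : ℕ × ProbabilityMeasure ℝ | K < θ.1} = Set.Ioi K ×ˢ Set.univ := by
    ext θ; simp
  rw [bernsteinPrior, hset, Measure.prod_prod, measure_univ, mul_one,
    PMF.toMeasure_apply _ measurableSet_Ioi, mul_comm, ENNReal.ofReal_mul (Real.exp_nonneg _),
    ENNReal.ofReal_tsum_of_nonneg (fun k => (Real.exp_pos _).le) hsum, ← ENNReal.tsum_mul_left]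
  refine ENNReal.tsum_le_tsum fun k => ?_
  by_cases hk : k ∈ Set.Ioi K
  · rw [Set.indicator_of_mem hk, ← ENNReal.ofReal_mul (Real.exp_nonneg _),
      ← ENNReal.ofReal_toReal (PMF.apply_ne_top p k)]
    refine ENNReal.ofReal_le_ofReal ((hk₀ k (hK.trans (le_of_lt hk))).trans ?_)
    -- Of the 4 k log k, half is at least 2 K log K and the rest exceeds k, leaving the summable
    -- factor exp(-k).
    rw [← Real.exp_add, Real.exp_le_exp]
    have hKk : (K : ℝ) ≤ k := by exact_mod_cast (le_of_lt hk)
    have hK3' : (3 : ℝ) ≤ K := by exact_mod_cast hK3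
    have hlog : Real.log K ≤ Real.log k := Real.log_le_log (by linarith) hKk
    have hlog1 : 1 ≤ Real.log K := by
      rw [Real.le_log_iff_exp_le (by linarith)]
      linarith [Real.exp_one_lt_d9]
    have h1 : (K : ℝ) * Real.log K ≤ k * Real.log k := by gcongr
    have h2 : (k : ℝ) * 1 ≤ k * Real.log k := by gcongr; linarith
    linarith
  · rw [Set.indicator_of_notMem hk]
    exact zero_le

/-- The parameters of order `k` whose cell masses are close to `w`. -/
def cellMassBall (k : ℕ) (w : ℕ → ℝ) (δ : ℝ) : Set (ℕ × ProbabilityMeasure ℝ) :=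
  {k} ×ˢ {P : ProbabilityMeasure ℝ | (P : Measure ℝ).real (Set.Ioc 0 1) = 1 ∧ ∀ j ∈ Finset.Icc 1 k, |cellMass k P j - w j| ≤ δ}

lemma measurableSet_cellMassBall (k : ℕ) (w : ℕ → ℝ) (δ : ℝ) :
    MeasurableSet (cellMassBall k w δ) :=
  (measurableSet_singleton k).prod
    ((measurableSet_eq_fun (measurable_real_apply measurableSet_Ioc) measurable_const).inter
      (measurable_forall_cellMass k w δ))

/-- Requiring full mass on (0, 1] in `cellMassBall` makes every density there integrate to exactly
1, as the chi-square bound needs, and removes only a null set. -/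
lemma bernsteinPrior_cellMassBall (hα : α (Set.Ioc 0 1)ᶜ = 0) (hD : IsDirichletProcess α D)
    (k : ℕ) (w : ℕ → ℝ) (δ : ℝ) :
    bernsteinPrior p D (cellMassBall k w δ) =
      p k * D {P | ∀ j ∈ Finset.Icc 1 k, |cellMass k P j - w j| ≤ δ} := by
  have := hD.isProbabilityMeasure
  rw [bernsteinPrior, cellMassBall, Measure.prod_prod, PMF.toMeasure_apply_singleton _ _ (measurableSet_singleton k)]
  congr 1
  refine measure_congr ?_
  filter_upwards [ae_real_Ioc_eq_one hα hD] with P hP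
  exact propext ⟨fun h => h.2, fun h => ⟨hP, h⟩⟩

/-- Prior mass near the coefficients `w`. -/
lemma exists_bernsteinPrior_cellMassBall_ge [IsFiniteMeasure α] (hα : α (Set.Ioc 0 1)ᶜ = 0)
    (hα_low : ∃ A b : ℝ, 0 < A ∧ ∀ k : ℕ, ∀ j ∈ Finset.Icc 1 k,
      A * (k : ℝ) ^ (-b) ≤ α.real (Set.Ioc (((j : ℝ) - 1) / k) ((j : ℝ) / k)))
    (hD : IsDirichletProcess α D)
    (hp_low : ∃ B β : ℝ, 0 < B ∧ 0 < β ∧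
      ∀ᶠ k : ℕ in atTop, B * Real.exp (-β * k * Real.log k) ≤ (p k).toReal) {c : ℝ} (hc : 0 < c) :
    ∃ B C : ℝ, 0 < B ∧ 0 < C ∧ ∀ᶠ k : ℕ in atTop, ∀ w : ℕ → ℝ, (∀ j ∈ Finset.Icc 1 k, c / k ≤ w j) →
      ∑ j ∈ Finset.Icc 1 k, w j = 1 →
      ENNReal.ofReal (B * Real.exp (-C * k * Real.log k)) ≤
        bernsteinPrior p D (cellMassBall k w (1 / (k : ℝ) ^ 2)) := by
  obtain ⟨B, β, hB, hβ, hp⟩ := hp_low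
  obtain ⟨C, hC, hball⟩ := exists_dirichletProcess_smallBall_ge hα hα_low hD hc
  refine ⟨B, β + C, hB, by positivity, ?_⟩
  filter_upwards [hp, hball] with k hpk hk w hw hsum
  rw [bernsteinPrior_cellMassBall hα hD]
  have e : B * Real.exp (-(β + C) * k * Real.log k) =
      B * Real.exp (-β * k * Real.log k) * Real.exp (-C * k * Real.log k) := by
    rw [mul_assoc B, ← Real.exp_add]; ring_nf
  rw [e, ENNReal.ofReal_mul (by positivity)]
  refine mul_le_mul' ?_ (hk w hw hsum)
  rw [← ENNReal.ofReal_toReal (PMF.apply_ne_top p k)]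
  exact ENNReal.ofReal_le_ofReal hpk

end Prior

/-! ### Arithmetic of the rate. -/

section Rate

/-- The inverse of the rate. -/
def scale (n : ℕ) : ℝ := ((n : ℝ) / Real.log n) ^ (1 / 3 : ℝ)

lemma tendsto_log_natCast : Tendsto (fun n : ℕ => Real.log n) atTop atTop :=
  Real.tendsto_log_atTop.comp tendsto_natCast_atTop_atTop

lemma eventually_rpow_le_scale : ∀ᶠ n : ℕ in atTop, (n : ℝ) ^ (1 / 6 : ℝ) ≤ scale n := by
  have h := ((isLittleO_log_rpow_atTop (show (0 : ℝ) < 1 / 2 by norm_num)).bound one_pos).natCast_atTop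
  filter_upwards [h, tendsto_log_natCast.eventually_ge_atTop 1, eventually_gt_atTop 0]
    with n hn hlog hn0
  have hn0' : (0 : ℝ) < n := by exact_mod_cast hn0
  rw [one_mul, Real.norm_eq_abs, Real.norm_eq_abs, abs_of_nonneg (by positivity),
    abs_of_nonneg (by positivity)] at hn
  have h1 : (n : ℝ) ^ (1 / 2 : ℝ) ≤ n / Real.log n := by
    rw [le_div_iff₀ (by positivity)]
    calc (n : ℝ) ^ (1 / 2 : ℝ) * Real.log n ≤ (n : ℝ) ^ (1 / 2 : ℝ) * (n : ℝ) ^ (1 / 2 : ℝ) := by gcongr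
      _ = n := by rw [← Real.rpow_add hn0']; norm_num
  calc (n : ℝ) ^ (1 / 6 : ℝ) = ((n : ℝ) ^ (1 / 2 : ℝ)) ^ (1 / 3 : ℝ) := by
        rw [← Real.rpow_mul hn0'.le]; norm_num
    _ ≤ scale n := Real.rpow_le_rpow (by positivity) h1 (by norm_num)

lemma tendsto_scale : Tendsto scale atTop atTop :=
  tendsto_atTop_mono' _ eventually_rpow_le_scale
    ((tendsto_rpow_atTop (by norm_num)).comp tendsto_natCast_atTop_atTop)

/-- Lets log K, for K of order `scale n`, be exchanged for log n in the prior tail. -/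
lemma eventually_log_le_log_scale : ∀ᶠ n : ℕ in atTop, Real.log n / 6 ≤ Real.log (scale n) := by
  filter_upwards [eventually_rpow_le_scale, eventually_gt_atTop 0] with n hn hn0
  have hn0' : (0 : ℝ) < n := by exact_mod_cast hn0
  have := Real.log_le_log (by positivity) hn
  rw [Real.log_rpow hn0'] at this
  linarith

lemma eventually_mul_scale_le (C : ℝ) : ∀ᶠ n : ℕ in atTop, C * scale n ≤ n := by
  have h : Tendsto (fun n : ℕ => (n : ℝ) ^ (2 / 3 : ℝ)) atTop atTop :=
    (tendsto_rpow_atTop (by norm_num)).comp tendsto_natCast_atTop_atTop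
  filter_upwards [h.eventually_ge_atTop (max C 0), tendsto_log_natCast.eventually_ge_atTop 1,
    eventually_gt_atTop 0] with n hn hlog hn0
  have hn0' : (0 : ℝ) < n := by exact_mod_cast hn0
  have h1 : scale n ≤ (n : ℝ) ^ (1 / 3 : ℝ) :=
    Real.rpow_le_rpow (by positivity) (div_le_self hn0'.le hlog) (by norm_num)
  have h0 : 0 ≤ scale n := by unfold scale; positivity
  calc C * scale n ≤ (n : ℝ) ^ (2 / 3 : ℝ) * (n : ℝ) ^ (1 / 3 : ℝ) :=
        mul_le_mul ((le_max_left _ _).trans hn) h1 h0 (by positivity)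
    _ = n := by rw [← Real.rpow_add hn0']; norm_num

lemma rate_mul_scale {n : ℕ} (hn : 1 ≤ Real.log n) : rate n * scale n = 1 := by
  have hn0 : (0 : ℝ) < n := by
    rcases Nat.eq_zero_or_pos n with rfl | h
    · norm_num at hn
    · exact_mod_cast h
  rw [rate, scale, Real.div_rpow hn0.le (by linarith)]
  have : (0 : ℝ) < Real.log n := by linarith
  field_simp

/-- The balance that determines the rate: it follows from n = `scale n` ^ 3 * log n and `rate n` = 1
/ `scale n`. -/
lemma mul_rate_sq {n : ℕ} (hn : 1 ≤ Real.log n) : n * rate n ^ 2 = scale n * Real.log n := by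
  have hn0 : (0 : ℝ) < n := by
    rcases Nat.eq_zero_or_pos n with rfl | h
    · norm_num at hn
    · exact_mod_cast h
  have hl : (0 : ℝ) < Real.log n := by linarith
  have h3 : scale n ^ 3 = n / Real.log n := by
    rw [scale, ← Real.rpow_natCast, ← Real.rpow_mul (by positivity)]; norm_num
  have hs : 0 < scale n := by unfold scale; positivity
  have hr : rate n = 1 / scale n := by
    rw [eq_div_iff hs.ne']; exact rate_mul_scale hn
  have hn' : (n : ℝ) = scale n ^ 3 * Real.log n := by rw [h3]; field_simp
  rw [hr]
  nth_rw 1 [hn']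
  field_simp

lemma rate_isLittleO : rate =o[atTop] fun n : ℕ =>
    Real.log n ^ (5 / 6 : ℝ) / (n : ℝ) ^ (1 / 3 : ℝ) := by
  have h : (fun x : ℝ => x ^ (1 / 3 : ℝ)) =o[atTop] fun x : ℝ => x ^ (5 / 6 : ℝ) := by
    have h1 : (fun _ : ℝ => (1 : ℝ)) =o[atTop] fun x : ℝ => x ^ (1 / 2 : ℝ) :=
      (Asymptotics.isLittleO_one_left_iff ℝ).2
        (tendsto_norm_atTop_atTop.comp (tendsto_rpow_atTop (by norm_num)))
    refine (h1.mul_isBigO (Asymptotics.isBigO_refl (fun x : ℝ => x ^ (1 / 3 : ℝ)) atTop)).congr'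
      (Eventually.of_forall fun x => one_mul _) ?_
    filter_upwards [eventually_gt_atTop 0] with x hx
    rw [← Real.rpow_add hx]; norm_num
  have h2 := (h.comp_tendsto tendsto_log_natCast).mul_isBigO
    (Asymptotics.isBigO_refl (fun n : ℕ => ((n : ℝ) ^ (1 / 3 : ℝ))⁻¹) atTop)
  refine h2.congr (fun n => ?_) fun n => ?_
  · rw [rate, Function.comp_apply, div_eq_mul_inv (Real.log n ^ (1 / 3 : ℝ))]
  · rw [Function.comp_apply, div_eq_mul_inv (Real.log n ^ (5 / 6 : ℝ))]

end Rate

/-! ### Choice of orders and constants; posterior contraction. -/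

/-- Densities in a small ball of cell masses are close to `g` in the chi-square sense. -/
lemma lintegral_inv_ratio_le_of_mem_cellMassBall {g : ℝ → ℝ} {c C : ℝ} (hg : IsPositiveDensity g)
    (hc : 0 < c) (hgc : ∀ x, c ≤ g x) {k : ℕ} (hk : k ≠ 0) {w : ℕ → ℝ}
    (hw : ∀ x ∈ Set.Ioo (0 : ℝ) 1, |betaMixture k w x - g x| ≤ C / k) (hCk : (1 + C) / k ≤ c / 2)
    {θ : ℕ × ProbabilityMeasure ℝ} (hθ : θ ∈ cellMassBall k w (1 / (k : ℝ) ^ 2)) :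
    ∫⁻ x in Set.Icc (0 : ℝ) 1, (ENNReal.ofReal (bernsteinModel θ x / g x))⁻¹ * ENNReal.ofReal (g x) ≤
      ENNReal.ofReal (1 + 2 / c * ((1 + C) / k) ^ 2) := by
  obtain ⟨h1, hP, hball⟩ := hθ
  obtain ⟨k', P⟩ := θ
  obtain rfl : k' = k := h1
  have hk0 : (0 : ℝ) < k' := by positivity
  rw [bernsteinModel_eq]
  refine lintegral_inv_ratio_le hg hc hgc (integrableOn_betaMixture _ _) ?_ (fun x hx => ?_) hCk
  · rw [setIntegral_betaMixture, sum_cellMass hk]; exact hP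
  · have e1 : |betaMixture k' (cellMass k' P) x - betaMixture k' w x| ≤ 1 / k' := by
      rw [betaMixture_sub]
      refine (abs_betaMixture_le hball hx).trans (le_of_eq ?_)
      field_simp
    calc _ ≤ _ := abs_sub_le _ (betaMixture k' w x) _
      _ ≤ 1 / k' + C / k' := add_le_add e1 (hw x hx)
      _ = _ := by rw [add_div]

lemma ofReal_pow_le_ofReal_exp {a b : ℝ} (h : a ≤ Real.exp b) (n : ℕ) :
    ENNReal.ofReal a ^ n ≤ ENNReal.ofReal (Real.exp (n * b)) := by
  rw [Real.exp_nat_mul, ENNReal.ofReal_pow (Real.exp_nonneg _)]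
  gcongr

section Contraction

variable {g : ℝ → ℝ} {p : PMF ℕ} {α : Measure ℝ} [IsFiniteMeasure α]
  {D : Measure (ProbabilityMeasure ℝ)}

/-- Prior mass of a chi-square neighbourhood whose radius is the rate. -/
lemma exists_priorMass {c C : ℝ} (hg : IsPositiveDensity g) (hc : 0 < c) (hgc : ∀ x, c ≤ g x)
    (hC : 0 < C)
    (happrox : ∀ k : ℕ, 2 ≤ k → ∃ w : ℕ → ℝ, (∀ j ∈ Finset.Icc 1 k, c / k ≤ w j) ∧
      ∑ j ∈ Finset.Icc 1 k, w j = 1 ∧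
      ∀ x ∈ Set.Ioo (0 : ℝ) 1, |betaMixture k w x - g x| ≤ C / k)
    (hα : α (Set.Ioc 0 1)ᶜ = 0)
    (hα_low : ∃ A b : ℝ, 0 < A ∧ ∀ k : ℕ, ∀ j ∈ Finset.Icc 1 k,
      A * (k : ℝ) ^ (-b) ≤ α.real (Set.Ioc (((j : ℝ) - 1) / k) ((j : ℝ) / k)))
    (hD : IsDirichletProcess α D)
    (hp_low : ∃ B β : ℝ, 0 < B ∧ 0 < β ∧
      ∀ᶠ k : ℕ in atTop, B * Real.exp (-β * k * Real.log k) ≤ (p k).toReal) :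
    ∃ B C₁ C₂ : ℝ, 0 < B ∧ 0 < C₁ ∧ 0 < C₂ ∧ ∀ᶠ n : ℕ in atTop,
      ∃ U : Set (ℕ × ProbabilityMeasure ℝ), MeasurableSet U ∧
        ENNReal.ofReal (B * Real.exp (-(C₂ * (scale n * Real.log n)))) ≤ bernsteinPrior p D U ∧
        ∀ θ ∈ U, ∫⁻ x in Set.Icc (0 : ℝ) 1,
          (ENNReal.ofReal (bernsteinModel θ x / g x))⁻¹ * ENNReal.ofReal (g x) ≤
            ENNReal.ofReal (1 + C₁ * rate n ^ 2) := by
  obtain ⟨B, C', hB, hC', hball⟩ := exists_bernsteinPrior_cellMassBall_ge hα hα_low hD hp_low hc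
  -- The order is k = ⌈`scale n`⌉: k ≥ 1 / `rate n` gives the chi-square constant, and k ≤ 2 *
  -- `scale n` with log k ≤ log n gives 2 C'.
  refine ⟨B, 2 / c * (1 + C) ^ 2, 2 * C', hB, by positivity, by positivity, ?_⟩
  have hceil : Tendsto (fun n : ℕ => ⌈scale n⌉₊) atTop atTop := tendsto_nat_ceil_atTop.comp tendsto_scale
  filter_upwards [hceil.eventually hball, hceil.eventually_ge_atTop 2,
    tendsto_scale.eventually_ge_atTop (max 1 (2 * (1 + C) / c)),
    tendsto_log_natCast.eventually_ge_atTop 1, eventually_mul_scale_le 1]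
    with n hn hk2 hscale hlog hle
  set k := ⌈scale n⌉₊
  obtain ⟨w, hw, hsum, hwx⟩ := happrox k hk2
  have hs1 : 1 ≤ scale n := (le_max_left _ _).trans hscale
  have hs2 : 2 * (1 + C) / c ≤ scale n := (le_max_right _ _).trans hscale
  have hsk : scale n ≤ k := Nat.le_ceil _
  have hk : (k : ℝ) ≤ 2 * scale n := by
    have := Nat.ceil_lt_add_one (show 0 ≤ scale n by linarith)
    linarith
  have hk0 : (0 : ℝ) < k := by linarith
  have hkn : k ≤ n := Nat.ceil_le.2 (by linarith)
  have hkn' : (k : ℝ) ≤ n := by exact_mod_cast hkn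
  have hδ : (1 + C) / k ≤ (1 + C) * rate n := by
    rw [div_le_iff₀ hk0, mul_assoc]
    have h1 := rate_mul_scale hlog
    have hr : 0 ≤ rate n := by unfold rate; positivity
    have h2 : 1 ≤ rate n * k := by rw [← h1]; gcongr
    nlinarith
  refine ⟨cellMassBall k w (1 / (k : ℝ) ^ 2), measurableSet_cellMassBall _ _ _,
    le_trans ?_ (hn w hw hsum), fun θ hθ => ?_⟩
  · refine ENNReal.ofReal_le_ofReal ?_
    gcongr
    have hl : Real.log k ≤ Real.log n := Real.log_le_log hk0 hkn'
    have hl0 : 0 ≤ Real.log k := Real.log_nonneg (by linarith)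
    have : (k : ℝ) * Real.log k ≤ 2 * scale n * Real.log n := by gcongr
    nlinarith
  · refine (lintegral_inv_ratio_le_of_mem_cellMassBall hg hc hgc (by omega) hwx ?_ hθ).trans
      (ENNReal.ofReal_le_ofReal ?_)
    · rw [div_le_iff₀ hk0]
      rw [div_le_iff₀ hc] at hs2
      nlinarith
    · have : ((1 + C) / k) ^ 2 ≤ ((1 + C) * rate n) ^ 2 := by gcongr
      have h2 : 2 / c * ((1 + C) / k) ^ 2 ≤ 2 / c * ((1 + C) * rate n) ^ 2 := by gcongr
      rw [mul_pow, ← mul_assoc] at h2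
      linarith

/-- Number of grid points, bounded by the exponential of a multiple of `n` times the square of the
rate. -/
lemma eventually_card_grid_le {C : ℝ} (hC : 1 ≤ C) :
    ∀ᶠ n : ℕ in atTop, (((⌈C * scale n⌉₊ + 1) * (⌈C * scale n⌉₊ * n ^ 2 + 1) ^ ⌈C * scale n⌉₊ : ℕ) : ℝ) ≤
      Real.exp (12 * C * (scale n * Real.log n)) := by
  filter_upwards [tendsto_scale.eventually_ge_atTop 1, eventually_mul_scale_le C,
    eventually_ge_atTop 2, tendsto_log_natCast.eventually_ge_atTop 1] with n hs hle hn hlog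
  set K := ⌈C * scale n⌉₊
  have hKn : K ≤ n := Nat.ceil_le.2 hle
  have hCs : 1 ≤ C * scale n := one_le_mul_of_one_le_of_one_le hC hs
  have hK : (K : ℝ) + 1 ≤ 3 * (C * scale n) := by
    have := Nat.ceil_lt_add_one (show 0 ≤ C * scale n by linarith)
    linarith
  have hn0 : (0 : ℝ) < n := by positivity
  -- K ≤ n bounds every factor by n⁴; then 4 (K + 1) ≤ 12 C `scale n`.
  have h1 : (K + 1) * (K * n ^ 2 + 1) ^ K ≤ (n ^ 4) ^ (K + 1) := by
    have e1 : K + 1 ≤ n ^ 4 := by nlinarith [pow_pos (show 0 < n by omega) 3, pow_le_pow_left₀ (by norm_num) hn 3]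
    have e2 : K * n ^ 2 + 1 ≤ n ^ 4 := by
      have : K * n ^ 2 ≤ n * n ^ 2 := Nat.mul_le_mul_right _ hKn
      nlinarith [pow_pos (show 0 < n by omega) 3]
    rw [pow_succ, mul_comm]
    exact Nat.mul_le_mul (Nat.pow_le_pow_left e2 K) e1
  calc _ ≤ (((n ^ 4) ^ (K + 1) : ℕ) : ℝ) := by exact_mod_cast h1
    _ = Real.exp (Real.log n * (4 * (K + 1))) := by
        rw [← Real.rpow_def_of_pos hn0, ← pow_mul]
        push_cast
        rw [← Real.rpow_natCast]
        push_cast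
        rfl
    _ ≤ _ := by
        rw [Real.exp_le_exp]
        nlinarith

/-- Posterior contraction at the rate `(log n / n) ^ (1 / 3)`. -/
theorem bernstein_posterior_contraction {c C : ℝ} (hg : IsPositiveDensity g) (hc : 0 < c)
    (hgc : ∀ x, c ≤ g x) (hC : 0 < C)
    (happrox : ∀ k : ℕ, 2 ≤ k → ∃ w : ℕ → ℝ, (∀ j ∈ Finset.Icc 1 k, c / k ≤ w j) ∧
      ∑ j ∈ Finset.Icc 1 k, w j = 1 ∧
      ∀ x ∈ Set.Ioo (0 : ℝ) 1, |betaMixture k w x - g x| ≤ C / k)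
    (hα : α (Set.Ioc 0 1)ᶜ = 0)
    (hα_low : ∃ A b : ℝ, 0 < A ∧ ∀ k : ℕ, ∀ j ∈ Finset.Icc 1 k,
      A * (k : ℝ) ^ (-b) ≤ α.real (Set.Ioc (((j : ℝ) - 1) / k) ((j : ℝ) / k)))
    (hD : IsDirichletProcess α D)
    (hp_up : ∀ᶠ k : ℕ in atTop, (p k).toReal ≤ Real.exp (-4 * k * Real.log k))
    (hp_low : ∃ B β : ℝ, 0 < B ∧ 0 < β ∧
      ∀ᶠ k : ℕ in atTop, B * Real.exp (-β * k * Real.log k) ≤ (p k).toReal) :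
    ∃ M₀ : ℝ, 0 < M₀ ∧ ∀ M : ℝ, M₀ ≤ M → ∀ η : ℝ≥0∞, 0 < η →
      Tendsto (fun n : ℕ => dataLaw g {x : ℕ → ℝ | η < posterior (bernsteinPrior p D) bernsteinModel n x
          {θ | M * rate n < hellinger (bernsteinModel θ) g}}) atTop (𝓝 0) := by
  have := hD.isProbabilityMeasure
  obtain ⟨B, C₁, C₂, hB, hC₁, hC₂, hprior⟩ :=
    exists_priorMass hg hc hgc hC happrox hα hα_low hD hp_low
  obtain ⟨C₅, hC₅, htail⟩ := exists_bernsteinPrior_tail_le (D := D) hp_up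
  -- In units of s = `scale n` * log n, the evidence may be as small as exp(-(C₂ + C₁ + 1) s) up to
  -- a constant; E leaves one spare exp(-s).
  set E := C₂ + C₁ + 2 with hE
  -- Since log K ≥ (log n) / 6, this makes 2 K log K at least (E + 1) s, which beats the factor
  -- exp(E s) in front of the prior tail.
  set C₃ := 3 * (E + 1) with hC₃
  have hC₃1 : 1 ≤ C₃ := by linarith
  -- M ≥ 1 gives M² / 2 ≥ M / 2 ≥ 12 C₃ + E / 2 + 1: bracket count, threshold exp(E s / 2) and a
  -- spare exp(-s).
  refine ⟨24 * C₃ + E + 2, by positivity, fun M hM η hη => ?_⟩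
  set s : ℕ → ℝ := fun n => scale n * Real.log n with hs
  have hsT : Tendsto s atTop atTop := tendsto_scale.atTop_mul_atTop₀ tendsto_log_natCast
  have hexp : Tendsto (fun n => Real.exp (-s n)) atTop (𝓝 0) :=
    Real.tendsto_exp_neg_atTop_nhds_zero.comp hsT
  have hlim : ∀ a : ℝ, Tendsto (fun n => ENNReal.ofReal (a * Real.exp (-s n))) atTop (𝓝 0) := fun a => by
    have := ENNReal.tendsto_ofReal (hexp.const_mul a)
    rwa [mul_zero, ENNReal.ofReal_zero] at this
  have hK : Tendsto (fun n : ℕ => ⌈C₃ * scale n⌉₊) atTop atTop :=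
    tendsto_nat_ceil_atTop.comp (tendsto_scale.const_mul_atTop (by positivity))
  refine tendsto_of_tendsto_of_tendsto_of_le_of_le' tendsto_const_nhds
    (hlim (1 + C₅ + Real.exp 1)) (Eventually.of_forall fun n => zero_le) ?_
  filter_upwards [hprior, hK.eventually htail, (hlim (8 / B)).eventually_le_const hη,
    eventually_card_grid_le hC₃1, eventually_log_le_log_scale,
    tendsto_scale.eventually_ge_atTop 1, tendsto_log_natCast.eventually_ge_atTop 1,
    eventually_ge_atTop 1] with n hU htl hηn hcard hlogs hscale hlog hn
  obtain ⟨U, hUm, hUp, hUq⟩ := hU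
  have hn0 : (0 : ℝ) < n := by exact_mod_cast hn
  have hs0 : 0 < s n := by simp only [hs]; positivity
  have hsn : n * rate n ^ 2 = s n := mul_rate_sq hlog
  set K := ⌈C₃ * scale n⌉₊ with hKdef
  have hK0 : 0 < K := Nat.ceil_pos.2 (by positivity)
  have hU0 : bernsteinPrior p D U ≠ 0 :=
    ((ENNReal.ofReal_pos.2 (by positivity)).trans_le hUp).ne'
  have hKlog : C₃ * s n / 6 ≤ K * Real.log K := by
    have h1 : C₃ * scale n ≤ K := Nat.le_ceil _
    have h2 : scale n ≤ K := le_trans (by nlinarith) h1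
    have h3 : Real.log n / 6 ≤ Real.log K := hlogs.trans (Real.log_le_log (by linarith) h2)
    calc C₃ * s n / 6 = C₃ * scale n * (Real.log n / 6) := by simp only [hs]; ring
      _ ≤ _ := by gcongr
  have hr : 0 ≤ rate n := by unfold rate; positivity
  have hM0 : 0 < M := lt_of_lt_of_le (by positivity) hM
  -- With τ = 1 / n the bracketing loss over n observations is only a factor exp 1, and K / G = τ²
  -- forces G = K n².
  have main := dataLaw_bernstein_posterior_gt_le hg p hUm hU0 hUq (K := K) (G := K * n ^ 2)
    (by positivity) (τ := 1 / n) (r := M * rate n) (by positivity)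
    (le_of_eq (by have : (0 : ℝ) < K := by exact_mod_cast hK0
                  push_cast; field_simp)) (by positivity) n
    ((C₁ + 1) * s n) (E * s n / 2) (E * s n)
  refine (measure_mono fun x hx => ?_).trans (main.trans ?_)
  · rw [Set.mem_ofPred_eq] at hx ⊢
    refine lt_of_le_of_lt (le_trans ?_ hηn) hx
    have e1 : (bernsteinPrior p D U)⁻¹ ≤ ENNReal.ofReal (B⁻¹ * Real.exp (C₂ * s n)) := by
      refine (ENNReal.inv_le_inv.2 hUp).trans (le_of_eq ?_)
      rw [← ENNReal.ofReal_inv_of_pos (by positivity), mul_inv, ← Real.exp_neg, neg_neg]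
    have e2 : 2 * (E * s n / 2) = E * s n := by ring
    rw [e2, ← ENNReal.ofReal_add (Real.exp_nonneg _) (Real.exp_nonneg _)]
    refine (mul_le_mul' (mul_le_mul' e1 le_rfl) le_rfl).trans (le_of_eq ?_)
    rw [← ENNReal.ofReal_mul (by positivity), ← ENNReal.ofReal_mul (by positivity)]
    congr 1
    have e3 : Real.exp (-s n) =
        Real.exp (C₂ * s n) * Real.exp ((C₁ + 1) * s n) * Real.exp (-(E * s n)) := by
      rw [← Real.exp_add, ← Real.exp_add, hE]; ring_nf
    rw [e3]
    field_simp
    ring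
  · have t1 : ENNReal.ofReal (Real.exp (-((C₁ + 1) * s n))) *
        ENNReal.ofReal (1 + C₁ * rate n ^ 2) ^ n ≤ ENNReal.ofReal (Real.exp (-s n)) := by
      have h := ofReal_pow_le_ofReal_exp (a := 1 + C₁ * rate n ^ 2) (b := C₁ * rate n ^ 2)
        (by linarith [Real.add_one_le_exp (C₁ * rate n ^ 2)]) n
      refine (mul_le_mul' le_rfl h).trans (le_of_eq ?_)
      rw [← ENNReal.ofReal_mul (Real.exp_nonneg _), ← Real.exp_add]
      congr 2
      linear_combination C₁ * hsn
    have t2 : ENNReal.ofReal (Real.exp (E * s n)) * bernsteinPrior p D {θ | K < θ.1} ≤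
        ENNReal.ofReal (C₅ * Real.exp (-s n)) := by
      refine (mul_le_mul' le_rfl htl).trans ?_
      rw [← ENNReal.ofReal_mul (Real.exp_nonneg _)]
      refine ENNReal.ofReal_le_ofReal ?_
      rw [mul_left_comm, ← Real.exp_add]
      gcongr
      rw [hC₃] at hKlog
      linarith
    have t3 : (((K + 1) * (K * n ^ 2 + 1) ^ K : ℕ) : ℝ≥0∞) * (ENNReal.ofReal (Real.exp (E * s n / 2)) *
        ENNReal.ofReal (1 - (M * rate n) ^ 2 / 2 + 1 / n) ^ n) ≤
          ENNReal.ofReal (Real.exp 1 * Real.exp (-s n)) := by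
      have h := ofReal_pow_le_ofReal_exp (a := 1 - (M * rate n) ^ 2 / 2 + 1 / n)
        (b := -(M * rate n) ^ 2 / 2 + 1 / n)
        (by linarith [Real.add_one_le_exp (-(M * rate n) ^ 2 / 2 + 1 / (n : ℝ))]) n
      have hc' : (((K + 1) * (K * n ^ 2 + 1) ^ K : ℕ) : ℝ≥0∞) ≤
          ENNReal.ofReal (Real.exp (12 * C₃ * s n)) := by
        rw [← ENNReal.ofReal_natCast]
        exact ENNReal.ofReal_le_ofReal hcard
      refine (mul_le_mul' hc' (mul_le_mul' le_rfl h)).trans ?_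
      rw [← ENNReal.ofReal_mul (Real.exp_nonneg _), ← ENNReal.ofReal_mul (Real.exp_nonneg _),
        ← Real.exp_add, ← Real.exp_add, ← Real.exp_add]
      refine ENNReal.ofReal_le_ofReal (Real.exp_le_exp.2 ?_)
      have e : (n : ℝ) * (-(M * rate n) ^ 2 / 2 + 1 / n) = -(M ^ 2 / 2) * s n + 1 := by
        rw [← hsn]; field_simp
      rw [e]
      have hMM : 12 * C₃ + E / 2 + 1 ≤ M ^ 2 / 2 := by nlinarith
      nlinarith
    refine (add_le_add (add_le_add t1 t2) t3).trans (le_of_eq ?_)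
    rw [← ENNReal.ofReal_add (by positivity) (by positivity),
      ← ENNReal.ofReal_add (by positivity) (by positivity)]
    congr 1
    ring

end Contraction

/-! ### Reduction to a density that is positive on the whole line. -/

section Extension

variable {f₀ : ℝ → ℝ}

/-- The continuous extension of `f₀` from `[0, 1]` that is constant on both sides. -/
def unitExtension (f₀ : ℝ → ℝ) : ℝ → ℝ :=
  Set.IccExtend (zero_le_one (α := ℝ)) ((Set.Icc (0 : ℝ) 1).domRestrict f₀)

lemma unitExtension_eq {x : ℝ} (hx : x ∈ Set.Icc (0 : ℝ) 1) : unitExtension f₀ x = f₀ x := by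
  rw [unitExtension, Set.IccExtend_of_mem _ _ hx, Set.domRestrict_apply]

lemma le_unitExtension {c : ℝ} (h : ∀ x ∈ Set.Icc (0 : ℝ) 1, c ≤ f₀ x) (x : ℝ) :
    c ≤ unitExtension f₀ x :=
  h _ (Set.projIcc 0 1 zero_le_one x).2

/-- Nothing is known about f₀ outside [0, 1], while likelihood ratios divide by the density at every
point; the data law and the Hellinger distance see only [0, 1], so the extension may replace f₀. -/
lemma dataLaw_unitExtension : dataLaw (unitExtension f₀) = dataLaw f₀ := by
  have : densityLaw (unitExtension f₀) = densityLaw f₀ :=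
    withDensity_congr_ae ((ae_restrict_mem measurableSet_Icc).mono fun x hx => by
      simp only [unitExtension_eq hx])
  rw [dataLaw, dataLaw, this]

lemma hellinger_unitExtension (f : ℝ → ℝ) : hellinger f (unitExtension f₀) = hellinger f f₀ := by
  rw [hellinger, hellinger]
  congr 1
  exact setIntegral_congr_fun measurableSet_Icc fun x hx => by simp only [unitExtension_eq hx]

lemma isPositiveDensity_unitExtension (hint : ∫ x in Set.Icc (0 : ℝ) 1, f₀ x = 1) {c : ℝ} (hc : 0 < c)
    (hf : ∀ x ∈ Set.Icc (0 : ℝ) 1, c ≤ f₀ x) (hcont : ContinuousOn f₀ (Set.Icc 0 1)) :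
    IsPositiveDensity (unitExtension f₀) := by
  have hcont' : Continuous (unitExtension f₀) :=
    (continuousOn_iff_continuous_domRestrict.1 hcont).Icc_extend'
  refine ⟨hcont'.measurable, fun x => hc.trans_le (le_unitExtension hf x),
    hcont'.integrableOn_Icc, ?_⟩
  exact (setIntegral_congr_fun measurableSet_Icc fun x hx => unitExtension_eq hx).trans hint

end Extension

end

end RandomBernstein

theorem mainTheorem4
    (f₀ : ℝ → ℝ)
    (hf₀_int : ∫ x in Set.Icc (0 : ℝ) 1, f₀ x = 1)
    (hf₀_pos : ∃ c : ℝ, 0 < c ∧ ∀ x ∈ Set.Icc (0 : ℝ) 1, c ≤ f₀ x)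
    (hf₀_diff : DifferentiableOn ℝ f₀ (Set.Icc 0 1))
    (hf₀_diff' : DifferentiableOn ℝ (derivWithin f₀ (Set.Icc 0 1)) (Set.Icc 0 1))
    (hf₀_bdd : ∃ L : ℝ, ∀ x ∈ Set.Icc (0 : ℝ) 1,
      |derivWithin (derivWithin f₀ (Set.Icc 0 1)) (Set.Icc 0 1) x| ≤ L)
    (α : Measure ℝ) [IsFiniteMeasure α]
    (hα_supp : α (Set.Ioc 0 1)ᶜ = 0)
    (hα_low : ∃ A b : ℝ, 0 < A ∧ ∀ k : ℕ, ∀ j ∈ Finset.Icc 1 k,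
      A * (k : ℝ) ^ (-b) ≤ α.real (Set.Ioc (((j : ℝ) - 1) / k) ((j : ℝ) / k)))
    (D : Measure (ProbabilityMeasure ℝ))
    (hD : RandomBernstein.IsDirichletProcess α D)
    (p : PMF ℕ)
    (hp_zero : p 0 = 0)
    (hp_anti : ∀ᶠ k : ℕ in atTop, p (k + 1) ≤ p k)
    (hp_up : ∀ᶠ k : ℕ in atTop, (p k).toReal ≤ Real.exp (-4 * k * Real.log k))
    (hp_low : ∃ B β : ℝ, 0 < B ∧ 0 < β ∧
      ∀ᶠ k : ℕ in atTop, B * Real.exp (-β * k * Real.log k) ≤ (p k).toReal) :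
    (∀ᵐ x ∂(RandomBernstein.dataLaw f₀), ∀ n : ℕ, IsProbabilityMeasure
      (RandomBernstein.posterior (RandomBernstein.bernsteinPrior p D)
        RandomBernstein.bernsteinModel n x)) ∧
    (∃ M₀ : ℝ, 0 < M₀ ∧ ∀ M : ℝ, M₀ ≤ M → ∀ η : ℝ≥0∞, 0 < η →
      Tendsto (fun n : ℕ => RandomBernstein.dataLaw f₀ {x : ℕ → ℝ | η <
        RandomBernstein.posterior (RandomBernstein.bernsteinPrior p D)
          RandomBernstein.bernsteinModel n x
          {θ | M * RandomBernstein.rate n <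
            RandomBernstein.hellinger (RandomBernstein.bernsteinModel θ) f₀}})
        atTop (𝓝 0)) ∧
    (RandomBernstein.rate =o[atTop] fun n : ℕ =>
      Real.log n ^ (5 / 6 : ℝ) / (n : ℝ) ^ (1 / 3 : ℝ)) := by
  obtain ⟨c, hc, hfc⟩ := hf₀_pos
  obtain ⟨L, hL⟩ := hf₀_bdd
  have := hD.isProbabilityMeasure
  -- The approximation uses f₀ itself, which has the derivatives; the probabilistic part uses the
  -- extension. They agree on (0, 1).
  have hg := RandomBernstein.isPositiveDensity_unitExtension hf₀_int hc hfc hf₀_diff.continuousOn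
  obtain ⟨C, hC, happrox⟩ :=
    RandomBernstein.exists_betaMixture_approx hf₀_int hfc hf₀_diff hf₀_diff' hL
  refine ⟨?_, ?_, RandomBernstein.rate_isLittleO⟩
  · rw [← RandomBernstein.dataLaw_unitExtension]
    exact RandomBernstein.isProbabilityMeasure_posterior hg
      RandomBernstein.measurable_uncurry_bernsteinModel RandomBernstein.bernsteinModel_nonneg
      RandomBernstein.setLIntegral_bernsteinModel_le
      (RandomBernstein.ae_bernsteinModel_pos hα_supp hD hp_zero)
  · rw [← RandomBernstein.dataLaw_unitExtension]
    simp only [← RandomBernstein.hellinger_unitExtension (f₀ := f₀)]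
    refine RandomBernstein.bernstein_posterior_contraction hg hc (RandomBernstein.le_unitExtension hfc)
      hC (fun k hk => ?_) hα_supp hα_low hD hp_up hp_low
    obtain ⟨w, hw, hsum, hx⟩ := happrox k hk
    exact ⟨w, hw, hsum, fun x hxI => by
      rw [RandomBernstein.unitExtension_eq (Set.Ioo_subset_Icc_self hxI)]; exact hx x hxI⟩
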